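/- Let $\xi$ be a real random variable with $\mathbb E\xi=0$, $\operatorname{Var}\xi=1$ and $\mathbb E|\xi|^{2+\varepsilon_0}\le M<\infty$ for some $\varepsilon_0>0$ (no other assumption is made on its law; in particular it may be discrete). For each $n\ge 1$ let $y_{i1},y_{i2}$, $1\le i\le n$, be independent copies of $\xi$, and for $s,t\in[-n\pi,n\pi]$ put $$S_n(s,t,Y)=\sum_{i=1}^n \bigl(y_{i1}\mathbf v_i+y_{i2}\mathbf v_i'\bigr)\in\mathbb R^4,$$ $$\mathbf v_i=\Bigl(\cos\tfrac{it}{n},-\tfrac in\sin\tfrac{it}{n},\cos\tfrac{is}{n},-\tfrac in\sin\tfrac{is}{n}\Bigr),\qquad \mathbf v_i'=\Bigl(\sin\tfrac{it}{n},\tfrac in\cos\tfrac{it}{n},\sin\tfrac{is}{n},\tfrac in\cos\tfrac{is}{n}\Bigr).$$ For $\tau>0$, say that $s,t\in[-n\pi,n\pi]$ satisfy Condition $(\tau)$ if there are no integers $k,l$, not both zero, with $|k|,|l|\le n^\tau$ and $$\Bigl\|k\frac{s}{\pi n}+l\frac{t}{\pi n}\Bigr\|_{\mathbb R/\mathbb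 Z}\le n^{-1+8\tau},$$ where $\|\cdot\|_{\mathbb R/\mathbb Z}$ is the distance to the nearest integer. **Theorem.** There is $\tau_0>0$ such that for all $0<\tau<\tau_0$, $C>0$, $\varepsilon_0>0$ and $M$ there is a constant $K=K(\tau,C,\varepsilon_0,M)$ with the following property. For every $\xi$ as above, every $n\ge1$, all $s,t\in[-n\pi,n\pi]$ satisfying Condition $(\tau)$, and every $a\in\mathbb R^4$, with $\delta=n^{-C}$ and $B(a,\delta)$ the open Euclidean ball, $$\mathbb P\Bigl(\tfrac1{\sqrt n}S_n(s,t,Y)\in B(a,\delta)\Bigr)\le K\,\delta^4 .$$ -/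

import Mathlib

open MeasureTheory ProbabilityTheory

noncomputable section

namespace TrigWalk

/-- The distance `‖x‖_{ℝ/ℤ}` from a real number to the nearest integer. -/
def distInt (x : ℝ) : ℝ := |x - (round x : ℝ)|

/-- The joint non-approximability condition (with parameter `τ`) on two numbers
`s, t ∈ [-nπ, nπ]`: no integers `k, l` with `|k|, |l| ≤ n ^ τ`, not both zero, satisfy
`‖k s / (π n) + l t / (π n)‖_{ℝ/ℤ} ≤ n ^ (-1 + 8 τ)`. -/
def JointCondition (τ : ℝ) (n : ℕ) (s t : ℝ) : Prop :=
  s ∈ Set.Icc (-(n * Real.pi)) (n * Real.pi) ∧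
  t ∈ Set.Icc (-(n * Real.pi)) (n * Real.pi) ∧
  ¬ ∃ k l : ℤ, |(k : ℝ)| ≤ (n : ℝ) ^ τ ∧ |(l : ℝ)| ≤ (n : ℝ) ^ τ ∧ ¬ (k = 0 ∧ l = 0) ∧
    distInt (k * (s / (Real.pi * n)) + l * (t / (Real.pi * n))) ≤ (n : ℝ) ^ (-1 + 8 * τ)

/-- The vector `v_i(s, t)` of `ℝ⁴`. -/
def v (n i : ℕ) (s t : ℝ) : EuclideanSpace ℝ (Fin 4) :=
  !₂[Real.cos (i * t / n), -((i : ℝ) / n) * Real.sin (i * t / n),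
     Real.cos (i * s / n), -((i : ℝ) / n) * Real.sin (i * s / n)]

/-- The vector `v'_i(s, t)` of `ℝ⁴`. -/
def v' (n i : ℕ) (s t : ℝ) : EuclideanSpace ℝ (Fin 4) :=
  !₂[Real.sin (i * t / n), ((i : ℝ) / n) * Real.cos (i * t / n),
     Real.sin (i * s / n), ((i : ℝ) / n) * Real.cos (i * s / n)]

/-- The walk `S_n(s, t, Y) = ∑_{i=1}^n (y_{i1} v_i(s, t) + y_{i2} v'_i(s, t))`. The coefficients
`y_{i1}, y_{i2}` for `1 ≤ i ≤ n` are `Y (i - 1) 0, Y (i - 1) 1`. -/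
def S (n : ℕ) (s t : ℝ) (Y : Fin n → Fin 2 → ℝ) : EuclideanSpace ℝ (Fin 4) :=
  ∑ i : Fin n, (Y i 0 • v n ((i : ℕ) + 1) s t + Y i 1 • v' n ((i : ℕ) + 1) s t)

end TrigWalk

end

/-! The bound is obtained from the decay of the characteristic function of the walk. Esseen's
inequality (`measureReal_ball_mul_volume_le`, with `r = δ⁻¹ = n ^ C`) reduces it to showing that the
characteristic function of `S / √n` has a bounded integral over the ball of radius `2 n ^ C`. By
independence this function is a product, over the steps, of values of the characteristic function
of `ξ`. Symmetrizing `ξ`, and using the moment bound to find a range `[1, R]` that the difference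
of two copies hits with probability bounded below (`exists_annulus_mass`), the product at `x`
is at most `exp (-c B)`, where `B` is a lower bound, uniform in `1 ≤ |w| ≤ R`, for the sum of
`1 - cos (w ⟪v_k, x⟫ / √n)` and `1 - cos (w ⟪v'_k, x⟫ / √n)` over `k`
(`prod_norm_charFun_le`).

The numbers `⟪v_k, x⟫` and `⟪v'_k, x⟫` are the real and imaginary parts of the wave
`h k = (x₀ + i x₁ k / n) e ^ {i k t / n} + (x₂ + i x₃ k / n) e ^ {i k s / n}`. Throughout, `{1, …, n}`
is cut into blocks of length about `n ^ (1 - τ)`; on such a block in the second half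
the amplitudes are almost constant and of order `‖x‖`, while the condition on `s` and `t` makes the
two frequencies beat many times, so that `h` has mean square of order `‖x‖ ^ 2`.

For `‖x‖ ≤ √n / R` all the arguments of the cosines are at most `π`, and this gives `B` of
order `‖x‖ ^ 2`: a Gaussian factor. For larger `‖x‖`, up to `2 n ^ C`, it is enough that on each block
some value of the rescaled wave is at distance bounded below from the Gaussian integers
(`exists_far_from_gaussianInt`), as this gives `B` of order `n ^ τ`. Suppose it fails, and let `p` be
the rounding of the wave. By Dirichlet there is `q ≤ n ^ τ` which is almost a period of both
exponentials, so a bounded number of differences of step `q` makes the wave tiny; the corresponding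
differences of `p` are then Gaussian integers of modulus less than one, that is, zero. Hence `p` is
a polynomial along each class modulo `q`, and its differences of step `q ℓ` vanish too, for every
`ℓ`. The condition on `s` and `t` provides an `ℓ` such that `q ℓ` is far from a period of either
exponential. The differences of step `q ℓ` of the wave are then as large as the wave itself in mean
square, but they are close to those of `p`, which vanish: a contradiction. -/

namespace TrigWalk

/-! ### Iterated forward differences -/

lemma fwdDiff_iter_succ_apply {G : Type*} [AddCommGroup G] (q m k : ℕ) (f : ℕ → G) :
    (fwdDiff q)^[m + 1] f k = (fwdDiff q)^[m] f (k + q) - (fwdDiff q)^[m] f k := by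
  rw [Function.iterate_succ_apply']; rfl

/-- Each difference of step `q` multiplies the main term of `(a + b k) w ^ k` by `w ^ q - 1`. -/
lemma fwdDiff_iter_affine_mul_pow (a b w : ℂ) (q m k : ℕ) :
    (fwdDiff q)^[m + 1] (fun k : ℕ => (a + b * k) * w ^ k) k =
      (w ^ q - 1) ^ m * ((w ^ q - 1) * (a + b * k) + (m + 1) * b * q * w ^ q) * w ^ k := by
  induction m generalizing k with
  | zero => simp only [zero_add, Function.iterate_one, fwdDiff]; push_cast; ring
  | succ m ih => rw [fwdDiff_iter_succ_apply, ih, ih]; push_cast; ring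

lemma norm_fwdDiff_iter_le (f : ℕ → ℂ) (q m k : ℕ) (B : ℝ)
    (h : ∀ j ≤ m, ‖f (k + j * q)‖ ≤ B) : ‖(fwdDiff q)^[m] f k‖ ≤ 2 ^ m * B := by
  induction m generalizing k with
  | zero => simpa using h 0 le_rfl
  | succ m ih =>
    rw [fwdDiff_iter_succ_apply]
    have h1 := ih (k + q) fun j hj => by
      have := h (j + 1) (by omega)
      rwa [show k + (j + 1) * q = k + q + j * q by ring] at this
    have h2 := ih k fun j hj => h j (by omega)
    calc _ ≤ _ := norm_sub_le _ _
      _ ≤ 2 ^ m * B + 2 ^ m * B := add_le_add h1 h2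
      _ = _ := by ring

lemma map_fwdDiff_iter {G G' : Type*} [AddCommGroup G] [AddCommGroup G'] (F : G →+ G')
    (f : ℕ → G) (q m k : ℕ) :
    F ((fwdDiff q)^[m] f k) = (fwdDiff q)^[m] (fun j => F (f j)) k := by
  induction m generalizing k with
  | zero => rfl
  | succ m ih => rw [fwdDiff_iter_succ_apply, fwdDiff_iter_succ_apply, map_sub, ih, ih]

lemma fwdDiff_iter_sub_apply (f g : ℕ → ℂ) (q m k : ℕ) :
    (fwdDiff q)^[m] (fun j => f j - g j) k = (fwdDiff q)^[m] f k - (fwdDiff q)^[m] g k := by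
  induction m generalizing k with
  | zero => rfl
  | succ m ih => simp only [fwdDiff_iter_succ_apply, ih]; ring

lemma fwdDiff_iter_add_apply (f g : ℕ → ℂ) (q m k : ℕ) :
    (fwdDiff q)^[m] (fun j => f j + g j) k = (fwdDiff q)^[m] f k + (fwdDiff q)^[m] g k := by
  induction m generalizing k with
  | zero => rfl
  | succ m ih => simp only [fwdDiff_iter_succ_apply, ih]; ring

/-- The operator `1 + T ^ q + ⋯ + T ^ (q (ℓ - 1))`, where `T` is the shift; it factors
the difference of step `q ℓ` through the difference of step `q`. -/
def stepSum {G : Type*} [AddCommGroup G] (q l : ℕ) (f : ℕ → G) (k : ℕ) : G :=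
  ∑ j ∈ Finset.range l, f (k + j * q)

lemma fwdDiff_mul_step {G : Type*} [AddCommGroup G] (q l : ℕ) :
    (fwdDiff (q * l) : (ℕ → G) → ℕ → G) = stepSum q l ∘ fwdDiff q := by
  funext f k
  have := Finset.sum_range_sub (fun j => f (k + j * q)) l
  simp only [Function.comp, stepSum, fwdDiff]
  rw [show k + q * l = k + l * q by ring]
  simp only [zero_mul, add_zero] at this
  rw [← this]
  exact Finset.sum_congr rfl fun j _ => by rw [show k + (j + 1) * q = k + j * q + q by ring]

lemma commute_stepSum_fwdDiff {G : Type*} [AddCommGroup G] (q l : ℕ) :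
    Function.Commute (stepSum q l : (ℕ → G) → ℕ → G) (fwdDiff q) := by
  intro f
  funext k
  simp only [stepSum, fwdDiff, Finset.sum_sub_distrib]
  congr 1
  exact Finset.sum_congr rfl fun j _ => by rw [show k + j * q + q = k + q + j * q by ring]

/-- A sequence whose `m`-th difference of step `q` vanishes on a window is a polynomial along each
class modulo `q`, so its `m`-th difference of step `q ℓ` vanishes as well. -/
lemma fwdDiff_iter_mul_step_eq_zero {G : Type*} [AddCommGroup G] (f : ℕ → G) (q l m a b : ℕ)
    (h : ∀ k, a ≤ k → k ≤ b → (fwdDiff q)^[m] f k = 0) (k : ℕ) (hk : a ≤ k)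
    (hk' : k + m * (q * l) ≤ b) : (fwdDiff (q * l))^[m] f k = 0 := by
  have key : ∀ (r : ℕ) (g : ℕ → G), (∀ k, a ≤ k → k ≤ b → g k = 0) →
      ∀ k, a ≤ k → k + r * (q * l) ≤ b → (stepSum q l)^[r] g k = 0 := by
    intro r
    induction r with
    | zero => intro g hg k h1 h2; exact hg k h1 (by simpa using h2)
    | succ r ih =>
      intro g hg k h1 h2
      rw [Function.iterate_succ_apply']
      refine Finset.sum_eq_zero fun j hj => ih g hg _ (by omega) ?_
      have : j * q ≤ q * l := by
        rw [mul_comm]; exact Nat.mul_le_mul_left _ (Finset.mem_range.1 hj).le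
      rw [add_mul] at h2
      omega
  rw [fwdDiff_mul_step, (commute_stepSum_fwdDiff q l).comp_iterate]
  exact key m _ h k hk hk'

/-! ### Rounding to Gaussian integers -/

/-- The Gaussian integer obtained by rounding both coordinates. -/
noncomputable def gaussRound (z : ℂ) : GaussianInt := ⟨round z.re, round z.im⟩

lemma norm_sub_gaussRound_sq (z : ℂ) :
    ‖z - GaussianInt.toComplex (gaussRound z)‖ ^ 2 = distInt z.re ^ 2 + distInt z.im ^ 2 := by
  rw [Complex.sq_norm, Complex.normSq_apply]
  simp [gaussRound, GaussianInt.toComplex_def, distInt, sq]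

lemma gaussianInt_eq_zero_of_norm_lt_one (g : GaussianInt)
    (h : ‖GaussianInt.toComplex g‖ < 1) : g = 0 := by
  have h1 : (g.norm : ℝ) < 1 := by
    rw [GaussianInt.intCast_real_norm, Complex.normSq_eq_norm_sq]
    nlinarith [norm_nonneg (GaussianInt.toComplex g)]
  have h2 : g.norm < 1 := by exact_mod_cast h1
  have h3 := GaussianInt.norm_nonneg g
  exact GaussianInt.norm_eq_zero.1 (by omega)

/-! ### Oscillating sums -/

lemma norm_geom_sum_le (z : ℂ) (hz : ‖z‖ = 1) (hz1 : z ≠ 1) (N : ℕ) :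
    ‖∑ j ∈ Finset.range N, z ^ j‖ ≤ 2 / ‖z - 1‖ := by
  rw [geom_sum_eq hz1, norm_div]
  gcongr
  calc _ ≤ ‖z ^ N‖ + ‖(1 : ℂ)‖ := norm_sub_le _ _
    _ = 2 := by simp [hz]; norm_num

lemma sum_norm_sq_two_frequencies (A B w u : ℂ) (hw : ‖w‖ = 1) (hu : ‖u‖ = 1) (hwu : w ≠ u)
    (k W : ℕ) :
    (W - 2 / ‖w - u‖) * (‖A‖ ^ 2 + ‖B‖ ^ 2) ≤
      ∑ j ∈ Finset.range W, ‖A * w ^ (k + j) + B * u ^ (k + j)‖ ^ 2 := by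
  set z := w * (starRingEnd ℂ) u with hz
  have huu : u * (starRingEnd ℂ) u = 1 := by
    rw [Complex.mul_conj, Complex.normSq_eq_norm_sq, hu]; simp
  have hz1 : ‖z‖ = 1 := by simp [hz, hw, hu]
  have hz2 : ‖z - 1‖ = ‖w - u‖ := by
    rw [← huu, hz, ← sub_mul, norm_mul, RCLike.norm_conj, hu, mul_one]
  have hzne : z ≠ 1 := by
    intro h
    rw [h, sub_self, norm_zero] at hz2
    exact hwu (sub_eq_zero.1 (norm_eq_zero.1 hz2.symm))
  have hterm : ∀ j, ‖A * w ^ (k + j) + B * u ^ (k + j)‖ ^ 2 =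
      ‖A‖ ^ 2 + ‖B‖ ^ 2 + 2 * ((A * (starRingEnd ℂ) B * z ^ k) * z ^ j).re := by
    intro j
    rw [Complex.sq_norm, Complex.normSq_add, Complex.normSq_eq_norm_sq, Complex.normSq_eq_norm_sq]
    simp only [norm_mul, norm_pow, hw, hu, one_pow, mul_one]
    congr 3
    rw [hz, map_mul, map_pow, mul_pow, mul_pow]
    ring
  simp_rw [hterm, Finset.sum_add_distrib, ← Finset.mul_sum, ← Complex.re_sum, ← Finset.mul_sum]
  have hb : |(A * (starRingEnd ℂ) B * z ^ k * ∑ j ∈ Finset.range W, z ^ j).re| ≤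
      ‖A‖ * ‖B‖ * (2 / ‖w - u‖) := by
    refine (Complex.abs_re_le_norm _).trans ?_
    rw [norm_mul, norm_mul, norm_mul, norm_pow, hz1, RCLike.norm_conj, one_pow, mul_one]
    gcongr
    rw [← hz2]
    exact norm_geom_sum_le z hz1 hzne W
  have hb' := (abs_le.1 hb).1
  have h0 : 0 ≤ 2 / ‖w - u‖ := by positivity
  have : 2 * (‖A‖ * ‖B‖) * (2 / ‖w - u‖) ≤ (‖A‖ ^ 2 + ‖B‖ ^ 2) * (2 / ‖w - u‖) := by
    gcongr
    nlinarith [sq_nonneg (‖A‖ - ‖B‖)]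
  simp only [Finset.sum_const, Finset.card_range, nsmul_eq_mul]
  nlinarith

/-- Stability of the two-frequency `L²` bound under a uniform perturbation. -/
lemma sum_norm_sq_ge_of_near (f : ℕ → ℂ) (A B w u : ℂ) (hw : ‖w‖ = 1) (hu : ‖u‖ = 1)
    (hwu : w ≠ u) (k W : ℕ) (e : ℝ)
    (hf : ∀ j < W, ‖f (k + j) - (A * w ^ (k + j) + B * u ^ (k + j))‖ ≤ e)
    (hW : 4 / ‖w - u‖ ≤ W) :
    W * ((‖A‖ ^ 2 + ‖B‖ ^ 2) / 4 - e ^ 2) ≤ ∑ j ∈ Finset.range W, ‖f (k + j)‖ ^ 2 := by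
  have h1 := sum_norm_sq_two_frequencies A B w u hw hu hwu k W
  have h2 : ∑ j ∈ Finset.range W, ‖A * w ^ (k + j) + B * u ^ (k + j)‖ ^ 2 ≤
      ∑ j ∈ Finset.range W, (2 * ‖f (k + j)‖ ^ 2 + 2 * e ^ 2) := by
    refine Finset.sum_le_sum fun j hj => ?_
    have h3 := hf j (Finset.mem_range.1 hj)
    have h4 : ‖A * w ^ (k + j) + B * u ^ (k + j)‖ ≤ ‖f (k + j)‖ + e := by
      have := norm_sub_norm_le (A * w ^ (k + j) + B * u ^ (k + j)) (f (k + j))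
      rw [norm_sub_rev] at this
      linarith
    nlinarith [norm_nonneg (A * w ^ (k + j) + B * u ^ (k + j)), sq_nonneg (‖f (k + j)‖ - e)]
  simp only [Finset.sum_add_distrib, ← Finset.mul_sum, Finset.sum_const, Finset.card_range,
    nsmul_eq_mul] at h2
  have h5 : 2 / ‖w - u‖ ≤ W / 2 := by
    have : 4 / ‖w - u‖ = 2 * (2 / ‖w - u‖) := by ring
    linarith
  have h6 : 0 ≤ ‖A‖ ^ 2 + ‖B‖ ^ 2 := by positivity
  nlinarith [mul_le_mul_of_nonneg_right h5 h6]

lemma two_mul_distInt_le_norm (α : ℝ) :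
    2 * distInt (α / Real.pi) ≤ ‖Complex.exp (α * Complex.I) - 1‖ := by
  have h1 : |Real.sin α| ≤ ‖Complex.exp (α * Complex.I) - 1‖ := by
    have := Complex.abs_im_le_norm (Complex.exp (α * Complex.I) - 1)
    simpa [Complex.exp_ofReal_mul_I_im] using this
  refine le_trans ?_ h1
  set y := α / Real.pi with hy
  have hα : α = y * Real.pi := by rw [hy]; field_simp
  set d := y - round y with hd
  have h2 : |Real.sin α| = |Real.sin (d * Real.pi)| := by
    have : α = d * Real.pi + (round y : ℤ) * Real.pi := by rw [hα, hd]; ring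
    rw [this, Real.sin_add_int_mul_pi, abs_mul]
    simp
  have hd2 : |d| ≤ 1 / 2 := abs_sub_round y
  have h3 : |Real.sin (d * Real.pi)| = |Real.sin (|d| * Real.pi)| := by
    rcases abs_choice d with h | h <;> rw [h]
    rw [neg_mul, Real.sin_neg, abs_neg]
  rw [h2, h3]
  have h4 := Real.mul_le_sin (x := |d| * Real.pi) (by positivity)
    (by nlinarith [Real.pi_pos])
  have h5 : 2 / Real.pi * (|d| * Real.pi) = 2 * |d| := by field_simp
  rw [h5] at h4
  exact h4.trans (le_abs_self _)

lemma abs_sum_cos_le (α ρ : ℝ) (hρ : 0 < ρ) (h : ρ ≤ ‖Complex.exp (α * Complex.I) - 1‖) (H : ℕ) :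
    |∑ l ∈ Finset.range H, Real.cos (l * α)| ≤ 2 / ρ := by
  have h1 : ∑ l ∈ Finset.range H, Real.cos (l * α) =
      (∑ l ∈ Finset.range H, Complex.exp (α * Complex.I) ^ l).re := by
    rw [Complex.re_sum]
    refine Finset.sum_congr rfl fun l _ => ?_
    rw [← Complex.exp_nat_mul, ← mul_assoc]
    have := Complex.exp_ofReal_mul_I_re (l * α)
    push_cast at this
    exact this.symm
  rw [h1]
  refine (Complex.abs_re_le_norm _).trans
    ((norm_geom_sum_le _ (Complex.norm_exp_ofReal_mul_I α) ?_ H).trans ?_)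
  · intro h2; rw [h2] at h; simp at h; linarith
  · gcongr

lemma norm_exp_sub_exp (α β : ℝ) :
    ‖Complex.exp (α * Complex.I) - Complex.exp (β * Complex.I)‖ =
      ‖Complex.exp ((α - β : ℝ) * Complex.I) - 1‖ := by
  have h : Complex.exp (α * Complex.I) - Complex.exp (β * Complex.I) =
      Complex.exp (β * Complex.I) * (Complex.exp ((α - β : ℝ) * Complex.I) - 1) := by
    rw [mul_sub, ← Complex.exp_add]
    congr 2
    · push_cast; ring
    · ring
  rw [h, norm_mul, Complex.norm_exp_ofReal_mul_I, one_mul]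

lemma norm_exp_sub_one_sq (α : ℝ) :
    ‖Complex.exp (α * Complex.I) - 1‖ ^ 2 = 2 * (1 - Real.cos α) := by
  rw [Complex.sq_norm, Complex.normSq_apply]
  simp only [Complex.sub_re, Complex.sub_im, Complex.exp_ofReal_mul_I_re,
    Complex.exp_ofReal_mul_I_im, Complex.one_re, Complex.one_im]
  nlinarith [Real.sin_sq_add_cos_sq α]

/-- Averaging `(1 - cos (ℓ α)) (1 - cos (ℓ β))` over `ℓ < H` gives almost `1` as soon as none of
`α`, `β`, `α ± β` is close to `2 π ℤ`, so some `ℓ` keeps both `ℓ α` and `ℓ β` away from `2 π ℤ`. -/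
lemma exists_separating_multiple (α β ρ : ℝ) (hρ : 0 < ρ)
    (h1 : ρ ≤ ‖Complex.exp (α * Complex.I) - 1‖)
    (h2 : ρ ≤ ‖Complex.exp (β * Complex.I) - 1‖)
    (h3 : ρ ≤ ‖Complex.exp ((α + β : ℝ) * Complex.I) - 1‖)
    (h4 : ρ ≤ ‖Complex.exp ((α - β : ℝ) * Complex.I) - 1‖) (H : ℕ) (hH : 12 / ρ ≤ H) :
    ∃ l < H, 1 / 2 ≤ ‖Complex.exp (α * Complex.I) ^ l - 1‖ ∧
      1 / 2 ≤ ‖Complex.exp (β * Complex.I) ^ l - 1‖ := by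
  have hH0 : (0 : ℝ) < H := lt_of_lt_of_le (by positivity) hH
  have hex : ∃ l ∈ Finset.range H,
      1 / 2 ≤ (1 - Real.cos (l * α)) * (1 - Real.cos (l * β)) := by
    by_contra! hcon
    have hlt := Finset.sum_lt_sum_of_nonempty
      (Finset.nonempty_range_iff.2 (by rintro rfl; simp at hH0)) hcon
    have heq : ∑ l ∈ Finset.range H, (1 - Real.cos (l * α)) * (1 - Real.cos (l * β)) =
        H - ∑ l ∈ Finset.range H, Real.cos (l * α) - ∑ l ∈ Finset.range H, Real.cos (l * β)
        + (1 / 2) * ∑ l ∈ Finset.range H, Real.cos (l * (α + β))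
        + (1 / 2) * ∑ l ∈ Finset.range H, Real.cos (l * (α - β)) := by
      rw [Finset.mul_sum, Finset.mul_sum]
      have : (H : ℝ) = ∑ l ∈ Finset.range H, (1 : ℝ) := by simp
      rw [this, ← Finset.sum_sub_distrib, ← Finset.sum_sub_distrib, ← Finset.sum_add_distrib,
        ← Finset.sum_add_distrib]
      refine Finset.sum_congr rfl fun l _ => ?_
      rw [mul_add (l : ℝ), mul_sub (l : ℝ), Real.cos_add, Real.cos_sub]
      ring
    have e1 := abs_le.1 (abs_sum_cos_le α ρ hρ h1 H)
    have e2 := abs_le.1 (abs_sum_cos_le β ρ hρ h2 H)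
    have e3 := abs_le.1 (abs_sum_cos_le (α + β) ρ hρ h3 H)
    have e4 := abs_le.1 (abs_sum_cos_le (α - β) ρ hρ h4 H)
    have e5 : 12 / ρ = 6 * (2 / ρ) := by ring
    simp only [Finset.sum_const, Finset.card_range, nsmul_eq_mul] at hlt
    linarith [e1.2, e2.2, e3.1, e4.1]
  obtain ⟨l, hl, hle⟩ := hex
  have hpow : ∀ γ : ℝ, ‖Complex.exp (γ * Complex.I) ^ l - 1‖ ^ 2 = 2 * (1 - Real.cos (l * γ)) := by
    intro γ
    rw [← norm_exp_sub_one_sq, ← Complex.exp_nat_mul]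
    push_cast
    rw [mul_assoc]
  have p1 := hpow α
  have p2 := hpow β
  have c1 := Real.neg_one_le_cos (l * α)
  have c2 := Real.neg_one_le_cos (l * β)
  have c3 := Real.cos_le_one (l * α)
  have c4 := Real.cos_le_one (l * β)
  refine ⟨l, Finset.mem_range.1 hl, ?_, ?_⟩
  · refine le_of_sq_le_sq ?_ (norm_nonneg _)
    rw [p1]; nlinarith
  · refine le_of_sq_le_sq ?_ (norm_nonneg _)
    rw [p2]; nlinarith

/-- Simultaneous Dirichlet approximation of two numbers, in multiplicative form. -/
lemma exists_simultaneous_return (α β : ℝ) (N : ℕ) (hN : 0 < N) :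
    ∃ q : ℕ, 0 < q ∧ q ≤ N ^ 3 ∧ ‖Complex.exp (α * Complex.I) ^ q - 1‖ ≤ 2 * Real.pi / N ∧
      ‖Complex.exp (β * Complex.I) ^ q - 1‖ ≤ 2 * Real.pi / N := by
  have hret : ∀ (γ : ℝ) (q : ℕ), ‖Complex.exp (γ * Complex.I) ^ q - 1‖ ≤
      2 * Real.pi * |q * (γ / (2 * Real.pi)) - round (q * (γ / (2 * Real.pi)))| := by
    intro γ q
    set y := q * (γ / (2 * Real.pi)) with hy
    have h1 : Complex.exp (γ * Complex.I) ^ q =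
        Complex.exp (Complex.I * ((2 * Real.pi * (y - round y) : ℝ) : ℂ)) := by
      rw [← Complex.exp_nat_mul]
      have h2 : (q : ℂ) * (γ * Complex.I) =
          Complex.I * ((2 * Real.pi * (y - round y) : ℝ) : ℂ)
            + (round y : ℤ) * (2 * Real.pi * Complex.I) := by
        have h3 : (q : ℝ) * γ = 2 * Real.pi * y := by rw [hy]; field_simp
        have h4 : (q : ℂ) * γ = 2 * Real.pi * (y : ℂ) := by exact_mod_cast congrArg Complex.ofReal h3
        rw [← mul_assoc, h4]; push_cast; ring
      rw [h2, Complex.exp_periodic.int_mul (round y)]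
    rw [h1]
    refine (Real.norm_exp_I_mul_ofReal_sub_one_le).trans ?_
    rw [Real.norm_eq_abs, abs_mul, abs_of_pos Real.two_pi_pos]
  obtain ⟨q₁, h0, h1, h2⟩ := Real.exists_nat_abs_mul_sub_round_le (α / (2 * Real.pi))
    (n := N ^ 2) (by positivity)
  obtain ⟨q₂, g0, g1, g2⟩ := Real.exists_nat_abs_mul_sub_round_le (q₁ * β / (2 * Real.pi)) hN
  have hN' : (0 : ℝ) < N := by exact_mod_cast hN
  refine ⟨q₁ * q₂, by positivity, ?_, ?_, ?_⟩
  · calc q₁ * q₂ ≤ N ^ 2 * N := Nat.mul_le_mul h1 g1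
      _ = N ^ 3 := by ring
  · -- the second multiplier costs at most a factor `N` in the first approximation
    have hb := (hret α q₁).trans (mul_le_mul_of_nonneg_left h2 Real.two_pi_pos.le)
    have hpow : ∀ (z : ℂ), ‖z‖ = 1 → ∀ m : ℕ, ‖z ^ m - 1‖ ≤ m * ‖z - 1‖ := by
      intro z hz m
      rw [← mul_geom_sum, norm_mul, mul_comm]
      gcongr
      refine (norm_sum_le _ _).trans ?_
      simp [hz]
    rw [pow_mul]
    refine (hpow _ (by simp [Complex.norm_exp_ofReal_mul_I]) q₂).trans ?_
    have g1' : (q₂ : ℝ) ≤ N := by exact_mod_cast g1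
    calc (q₂ : ℝ) * _ ≤ N * (2 * Real.pi * (1 / ((N ^ 2 : ℕ) + 1))) := by gcongr
      _ ≤ N * (2 * Real.pi * (1 / N ^ 2)) := by
          push_cast; gcongr; linarith
      _ = _ := by field_simp
  · have := hret β (q₁ * q₂)
    have e : ((q₁ * q₂ : ℕ) : ℝ) * (β / (2 * Real.pi)) = q₂ * (q₁ * β / (2 * Real.pi)) := by
      push_cast; ring
    rw [e] at this
    refine this.trans ((mul_le_mul_of_nonneg_left g2 Real.two_pi_pos.le).trans ?_)
    rw [mul_one_div]
    gcongr
    linarith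

/-! ### Waves of two frequencies with affine amplitudes -/

lemma norm_fwdDiff_iter_sub_le (a b w : ℂ) (hw : ‖w‖ = 1) (m Q k j : ℕ) (R : ℝ)
    (hj : (j : ℝ) ≤ R) (hQ : (Q : ℝ) ≤ R) :
    ‖(fwdDiff Q)^[m + 1] (fun k : ℕ => (a + b * k) * w ^ k) (k + j) -
      (w ^ Q - 1) ^ (m + 1) * (a + b * k) * w ^ (k + j)‖ ≤ 2 ^ (m + 1) * (m + 2) * (‖b‖ * R) := by
  have hz : ‖w ^ Q - 1‖ ≤ 2 := (norm_sub_le _ _).trans (by simp [hw]; norm_num)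
  have hR : 0 ≤ R := (Nat.cast_nonneg _).trans hj
  have e : (fwdDiff Q)^[m + 1] (fun k : ℕ => (a + b * k) * w ^ k) (k + j) -
      (w ^ Q - 1) ^ (m + 1) * (a + b * k) * w ^ (k + j) =
      (w ^ Q - 1) ^ m * ((w ^ Q - 1) * (b * j) + (m + 1 : ℕ) * (b * Q) * w ^ Q) * w ^ (k + j) := by
    rw [fwdDiff_iter_affine_mul_pow]; push_cast; ring
  rw [e, norm_mul, norm_mul, norm_pow, norm_pow, hw, one_pow, mul_one]
  have h1 : ‖(w ^ Q - 1) * (b * j) + (m + 1 : ℕ) * (b * Q) * w ^ Q‖ ≤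
      2 * (‖b‖ * R) + (m + 1) * (‖b‖ * R) := by
    refine (norm_add_le _ _).trans ?_
    simp only [norm_mul, norm_pow, hw, one_pow, mul_one, Complex.norm_natCast]
    push_cast
    gcongr
  calc _ ≤ 2 ^ m * (2 * (‖b‖ * R) + (m + 1) * (‖b‖ * R)) := by gcongr
    _ ≤ _ := by
      have : 0 ≤ ‖b‖ * R := by positivity
      have h2 : 2 * (‖b‖ * R) + (m + 1) * (‖b‖ * R) ≤ 2 * (m + 2) * (‖b‖ * R) := by
        have : (0 : ℝ) ≤ m := Nat.cast_nonneg _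
        nlinarith
      calc _ ≤ 2 ^ m * (2 * (m + 2) * (‖b‖ * R)) := by gcongr
        _ = _ := by ring

lemma norm_fwdDiff_iter_small (a b w : ℂ) (hw : ‖w‖ = 1) (m q n k : ℕ) (X z : ℝ)
    (hz : ‖w ^ q - 1‖ ≤ z) (hq : (q : ℝ) ≤ z * n) (hb : ‖b‖ * n ≤ X) (ha : ‖a + b * k‖ ≤ X) :
    ‖(fwdDiff q)^[m + 1] (fun k : ℕ => (a + b * k) * w ^ k) k‖ ≤ (m + 2) * z ^ (m + 1) * X := by
  have hz0 : 0 ≤ z := (norm_nonneg _).trans hz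
  have hX : 0 ≤ X := (norm_nonneg _).trans ha
  have hbq : ‖b‖ * q ≤ z * X := by
    calc ‖b‖ * q ≤ ‖b‖ * (z * n) := by gcongr
      _ = z * (‖b‖ * n) := by ring
      _ ≤ _ := by gcongr
  rw [fwdDiff_iter_affine_mul_pow, norm_mul, norm_mul, norm_pow, norm_pow, hw, one_pow, mul_one]
  have h1 : ‖(w ^ q - 1) * (a + b * k) + (m + 1) * b * q * w ^ q‖ ≤ z * X + (m + 1) * (z * X) := by
    refine (norm_add_le _ _).trans ?_
    have : ((m : ℂ) + 1) * b * q * w ^ q = (m + 1 : ℕ) * (b * q) * w ^ q := by push_cast; ring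
    rw [this]
    simp only [norm_mul, norm_pow, hw, one_pow, mul_one, Complex.norm_natCast]
    push_cast
    gcongr
  calc _ ≤ z ^ m * (z * X + (m + 1) * (z * X)) := by gcongr
    _ = _ := by ring

/-- The complex number whose real and imaginary parts are `⟪v_k, x⟫` and `⟪v'_k, x⟫`: a sum
of two exponential waves with affine amplitudes. -/
noncomputable def wave (n : ℕ) (s t : ℝ) (x : EuclideanSpace ℝ (Fin 4)) (k : ℕ) : ℂ :=
  ((x 0 : ℂ) + ((x 1 / n : ℝ) * Complex.I) * k) * Complex.exp ((t / n : ℝ) * Complex.I) ^ k +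
  ((x 2 : ℂ) + ((x 3 / n : ℝ) * Complex.I) * k) * Complex.exp ((s / n : ℝ) * Complex.I) ^ k

lemma norm_amplitude_sq (x y : ℝ) (n k : ℕ) :
    ‖(x : ℂ) + ((y / n : ℝ) * Complex.I) * k‖ ^ 2 = x ^ 2 + y ^ 2 * ((k : ℝ) / n) ^ 2 := by
  have : (x : ℂ) + ((y / n : ℝ) * Complex.I) * k = (x : ℂ) + ((y * (k / n) : ℝ) : ℂ) * Complex.I := by
    push_cast; ring
  rw [this, Complex.sq_norm, Complex.normSq_add_mul_I]
  ring

lemma norm_amplitude_slope (y : ℝ) (n : ℕ) (hn : 0 < n) :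
    ‖((y / n : ℝ) : ℂ) * Complex.I‖ * n = |y| := by
  have : (0 : ℝ) < n := by exact_mod_cast hn
  rw [norm_mul, Complex.norm_I, mul_one, Complex.norm_real, Real.norm_eq_abs, abs_div,
    abs_of_pos this]
  field_simp

lemma norm_sq_eq_four (x : EuclideanSpace ℝ (Fin 4)) :
    ‖x‖ ^ 2 = x 0 ^ 2 + x 1 ^ 2 + x 2 ^ 2 + x 3 ^ 2 := by
  rw [EuclideanSpace.real_norm_sq_eq, Fin.sum_univ_four]

/-- The amplitudes of a wave with indices `k ∈ [n / 2, n]` are of order `‖x‖`. -/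
lemma amplitude_sq_lower (n k : ℕ) (hn : 0 < n) (hk : n ≤ 2 * k)
    (x : EuclideanSpace ℝ (Fin 4)) :
    ‖x‖ ^ 2 / 4 ≤ ‖(x 0 : ℂ) + ((x 1 / n : ℝ) * Complex.I) * k‖ ^ 2 +
      ‖(x 2 : ℂ) + ((x 3 / n : ℝ) * Complex.I) * k‖ ^ 2 := by
  rw [norm_amplitude_sq, norm_amplitude_sq, norm_sq_eq_four]
  have hn' : (0 : ℝ) < n := by exact_mod_cast hn
  have h1 : (1 : ℝ) / 2 ≤ (k : ℝ) / n := by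
    rw [div_le_div_iff₀ (by norm_num) hn']
    have : (n : ℝ) ≤ 2 * k := by exact_mod_cast hk
    linarith
  have h2 : (1 : ℝ) / 4 ≤ ((k : ℝ) / n) ^ 2 := by nlinarith
  nlinarith [sq_nonneg (x 0), sq_nonneg (x 2), mul_le_mul_of_nonneg_left h2 (sq_nonneg (x 1)),
    mul_le_mul_of_nonneg_left h2 (sq_nonneg (x 3))]

lemma amplitude_le (n k : ℕ) (hn : 0 < n) (hk : k ≤ n) (x y X : ℝ) (hX : 0 ≤ X)
    (h : x ^ 2 + y ^ 2 ≤ X ^ 2) : ‖(x : ℂ) + ((y / n : ℝ) * Complex.I) * k‖ ≤ X := by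
  refine le_of_sq_le_sq ?_ hX
  rw [norm_amplitude_sq]
  have hn' : (0 : ℝ) < n := by exact_mod_cast hn
  have h1 : (k : ℝ) / n ≤ 1 := by
    rw [div_le_one hn']; exact_mod_cast hk
  have h2 : ((k : ℝ) / n) ^ 2 ≤ 1 := by
    have : 0 ≤ (k : ℝ) / n := by positivity
    nlinarith
  nlinarith [mul_le_mul_of_nonneg_left h2 (sq_nonneg y)]

lemma abs_coord_le (x : EuclideanSpace ℝ (Fin 4)) (i : Fin 4) : |x i| ≤ ‖x‖ := by
  simpa using PiLp.norm_apply_le x i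

/-- On a block of consecutive indices that is short compared with `n` but long compared with the
beat of the two frequencies, the wave has mean square of order `‖x‖ ^ 2`. -/
lemma sum_norm_sq_wave_block (n : ℕ) (hn : 0 < n) (s t : ℝ) (x : EuclideanSpace ℝ (Fin 4))
    (L k₀ : ℕ) (hk₀ : n ≤ 2 * k₀) (hL : 16 * L ≤ n)
    (hne : Complex.exp ((t / n : ℝ) * Complex.I) ≠ Complex.exp ((s / n : ℝ) * Complex.I))
    (hbeat : 4 / ‖Complex.exp ((t / n : ℝ) * Complex.I) - Complex.exp ((s / n : ℝ) * Complex.I)‖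
      ≤ L) :
    L * (‖x‖ ^ 2 / 32) ≤ ∑ j ∈ Finset.range L, ‖wave n s t x (k₀ + j)‖ ^ 2 := by
  have hw := Complex.norm_exp_ofReal_mul_I (t / n)
  have hu := Complex.norm_exp_ofReal_mul_I (s / n)
  have hwave : wave n s t x = fun k : ℕ =>
    ((x 0 : ℂ) + ((x 1 / n : ℝ) * Complex.I) * k) * Complex.exp ((t / n : ℝ) * Complex.I) ^ k +
    ((x 2 : ℂ) + ((x 3 / n : ℝ) * Complex.I) * k) * Complex.exp ((s / n : ℝ) * Complex.I) ^ k := rfl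
  set w := Complex.exp ((t / n : ℝ) * Complex.I)
  set u := Complex.exp ((s / n : ℝ) * Complex.I)
  have hn' : (0 : ℝ) < n := by exact_mod_cast hn
  have hL' : 16 * (L : ℝ) ≤ n := by exact_mod_cast hL
  have hslope : ∀ i, ‖((x i / n : ℝ) : ℂ) * Complex.I‖ * L ≤ ‖x‖ / 16 := by
    intro i
    have h1 := norm_amplitude_slope (x i) n hn
    have h2 := abs_coord_le x i
    nlinarith [norm_nonneg (((x i / n : ℝ) : ℂ) * Complex.I)]
  have key := sum_norm_sq_ge_of_near (wave n s t x)
    ((x 0 : ℂ) + ((x 1 / n : ℝ) * Complex.I) * k₀) ((x 2 : ℂ) + ((x 3 / n : ℝ) * Complex.I) * k₀)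
    w u hw hu hne k₀ L (‖x‖ / 8) ?_ hbeat
  · refine le_trans ?_ key
    gcongr
    have := amplitude_sq_lower n k₀ hn hk₀ x
    nlinarith
  · intro j hj
    have e : wave n s t x (k₀ + j) - (((x 0 : ℂ) + ((x 1 / n : ℝ) * Complex.I) * k₀) * w ^ (k₀ + j)
        + ((x 2 : ℂ) + ((x 3 / n : ℝ) * Complex.I) * k₀) * u ^ (k₀ + j)) =
        ((x 1 / n : ℝ) * Complex.I) * j * w ^ (k₀ + j) +
        ((x 3 / n : ℝ) * Complex.I) * j * u ^ (k₀ + j) := by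
      rw [hwave]; push_cast; ring
    rw [e]
    refine (norm_add_le _ _).trans ?_
    rw [norm_mul, norm_mul, norm_mul _ (u ^ _), norm_mul _ (j : ℂ), norm_pow, norm_pow, hw, hu,
      Complex.norm_natCast]
    simp only [one_pow, mul_one]
    have hj' : (j : ℝ) ≤ L := by exact_mod_cast hj.le
    have := hslope 1
    have := hslope 3
    have h1 := mul_le_mul_of_nonneg_left hj' (norm_nonneg (((x 1 / n : ℝ) : ℂ) * Complex.I))
    have h2 := mul_le_mul_of_nonneg_left hj' (norm_nonneg (((x 3 / n : ℝ) : ℂ) * Complex.I))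
    linarith

/-- Differences of a step `Q` far from a period of either frequency preserve the order of magnitude
of a wave, in mean square over a window of length `W ≤ L`. -/
lemma sum_norm_sq_fwdDiff_ge (n : ℕ) (hn : 0 < n) (a b c d w u : ℂ) (hw : ‖w‖ = 1) (hu : ‖u‖ = 1)
    (hwu : w ≠ u) (m Q k₀ L W : ℕ) (X : ℝ) (hX : 0 ≤ X) (hQ : Q ≤ L) (hWL : W ≤ L)
    (hwQ : 1 / 2 ≤ ‖w ^ Q - 1‖) (huQ : 1 / 2 ≤ ‖u ^ Q - 1‖) (hb : ‖b‖ * n ≤ X) (hd : ‖d‖ * n ≤ X)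
    (hamp : X ^ 2 / 4 ≤ ‖a + b * k₀‖ ^ 2 + ‖c + d * k₀‖ ^ 2)
    (hLn : 2 * (2 ^ (m + 1) * (m + 2)) * (L / n : ℝ) ≤ (1 / 2) ^ (m + 1) / 8)
    (hbeat : 4 / ‖w - u‖ ≤ W) :
    W * (3 * ((1 / 2) ^ (m + 1) * X / 8) ^ 2) ≤ ∑ j ∈ Finset.range W,
      ‖(fwdDiff Q)^[m + 1] (fun k : ℕ => (a + b * k) * w ^ k + (c + d * k) * u ^ k) (k₀ + j)‖ ^ 2 := by
  have hn' : (0 : ℝ) < n := by exact_mod_cast hn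
  have hQ' : (Q : ℝ) ≤ L := by exact_mod_cast hQ
  have hlow := sum_norm_sq_ge_of_near
    ((fwdDiff Q)^[m + 1] (fun k : ℕ => (a + b * k) * w ^ k + (c + d * k) * u ^ k))
    ((w ^ Q - 1) ^ (m + 1) * (a + b * k₀)) ((u ^ Q - 1) ^ (m + 1) * (c + d * k₀))
    w u hw hu hwu k₀ W
    (2 ^ (m + 1) * (m + 2) * (‖b‖ * L) + 2 ^ (m + 1) * (m + 2) * (‖d‖ * L)) ?_ hbeat
  · refine le_trans ?_ hlow
    gcongr
    have hA : ∀ y r : ℂ, 1 / 2 ≤ ‖y‖ → ((1 / 2) ^ (m + 1)) ^ 2 * ‖r‖ ^ 2 ≤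
        ‖y ^ (m + 1) * r‖ ^ 2 := by
      intro y r hy
      rw [norm_mul, norm_pow, mul_pow]
      gcongr
    have hA1 := hA _ (a + b * k₀) hwQ
    have hA2 := hA _ (c + d * k₀) huQ
    have he : 2 ^ (m + 1) * (m + 2) * (‖b‖ * L) + 2 ^ (m + 1) * (m + 2) * (‖d‖ * L) ≤
        (1 / 2) ^ (m + 1) * X / 8 := by
      have e0 : ∀ y : ℂ, ‖y‖ * n ≤ X → ‖y‖ * L ≤ X * (L / n) := by
        intro y hy
        rw [mul_div_assoc', le_div_iff₀ hn']
        have : (0 : ℝ) ≤ L := Nat.cast_nonneg _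
        nlinarith
      have e1 := e0 _ hb
      have e3 := e0 _ hd
      calc _ ≤ 2 ^ (m + 1) * (m + 2) * (X * (L / n)) + 2 ^ (m + 1) * (m + 2) * (X * (L / n)) := by
            gcongr
        _ = 2 * (2 ^ (m + 1) * (m + 2)) * (L / n : ℝ) * X := by ring
        _ ≤ (1 / 2) ^ (m + 1) / 8 * X := by gcongr
        _ = _ := by ring
    have he2 : (2 ^ (m + 1) * (m + 2) * (‖b‖ * L) + 2 ^ (m + 1) * (m + 2) * (‖d‖ * L)) ^ 2 ≤
        ((1 / 2) ^ (m + 1) * X / 8) ^ 2 := by gcongr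
    have hamp' := mul_le_mul_of_nonneg_left hamp (sq_nonneg ((1 / 2 : ℝ) ^ (m + 1)))
    generalize (1 / 2 : ℝ) ^ (m + 1) = κ at *
    linarith
  · intro j hj
    have hj' : (j : ℝ) ≤ L := by
      have : j ≤ L := by omega
      exact_mod_cast this
    have e1 := norm_fwdDiff_iter_sub_le a b w hw m Q k₀ j L hj' hQ'
    have e2 := norm_fwdDiff_iter_sub_le c d u hu m Q k₀ j L hj' hQ'
    rw [fwdDiff_iter_add_apply, add_sub_add_comm]
    exact (norm_add_le _ _).trans (add_le_add e1 e2)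

/-- If a sequence stays close to the Gaussian integers on a window and has small `M`-th differences
of step `q`, then its rounding has vanishing `M`-th differences of step `q`, hence also of step
`q ℓ`, and so the sequence has small `M`-th differences of step `q ℓ`. -/
lemma norm_fwdDiff_iter_mul_step_le (f : ℕ → ℂ) (M q l k₀ L : ℕ) (η : ℝ)
    (hclose : ∀ k, k₀ ≤ k → k < k₀ + L →
      ‖f k - GaussianInt.toComplex (gaussRound (f k))‖ ≤ η)
    (hη : 2 ^ M * η ≤ 1 / 4)
    (hsmall : ∀ k, k₀ ≤ k → k + M * q < k₀ + L → ‖(fwdDiff q)^[M] f k‖ ≤ 1 / 4)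
    (k : ℕ) (hk : k₀ ≤ k) (hk' : k + M * (q * l) + M * q < k₀ + L) :
    ‖(fwdDiff (q * l))^[M] f k‖ ≤ 2 ^ M * η := by
  set p : ℕ → GaussianInt := fun k => gaussRound (f k) with hp
  have hdiff : ∀ Q k, k₀ ≤ k → k + M * Q < k₀ + L →
      ‖(fwdDiff Q)^[M] f k - GaussianInt.toComplex ((fwdDiff Q)^[M] p k)‖ ≤ 2 ^ M * η := by
    intro Q k h1 h2
    have e : GaussianInt.toComplex ((fwdDiff Q)^[M] p k) =
      (fwdDiff Q)^[M] (fun j => GaussianInt.toComplex (p j)) k :=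
      map_fwdDiff_iter GaussianInt.toComplex.toAddMonoidHom p Q M k
    rw [e, ← fwdDiff_iter_sub_apply]
    refine norm_fwdDiff_iter_le _ _ _ _ _ fun j hj => hclose _ (by omega) ?_
    have := Nat.mul_le_mul_right Q hj
    omega
  have hvan : ∀ k, k₀ ≤ k → k + M * q < k₀ + L → (fwdDiff q)^[M] p k = 0 := by
    intro k h1 h2
    refine gaussianInt_eq_zero_of_norm_lt_one _ ?_
    have h3 := hdiff q k h1 h2
    have h4 := hsmall k h1 h2
    have h5 := norm_sub_norm_le (GaussianInt.toComplex ((fwdDiff q)^[M] p k))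
      ((fwdDiff q)^[M] f k)
    rw [norm_sub_rev] at h5
    linarith
  have h1 := fwdDiff_iter_mul_step_eq_zero p q l M k₀ (k₀ + L - 1 - M * q)
    (fun k h1 h2 => hvan k h1 (by omega)) k hk (by omega)
  have h2 := hdiff (q * l) k hk (by omega)
  rwa [h1, map_zero, sub_zero] at h2

/-- On a short block of consecutive indices, a wave of large amplitude cannot stay close to the
Gaussian integers. If it did, its rounding `p` would have vanishing differences of order `m + 1`
and step `q`, where `q` is a common near-period of the two frequencies; hence `p` would also have
vanishing differences of step `q ℓ`. Choosing `ℓ` such that `q ℓ` is far from a period of either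
frequency, the differences of the wave itself keep its order of magnitude. -/
lemma exists_far_from_gaussianInt (n : ℕ) (hn : 0 < n) (s t : ℝ) (x : EuclideanSpace ℝ (Fin 4))
    (m q H L k₀ : ℕ) (z ρ c η : ℝ) (hq : 0 < q) (hρ : 0 < ρ) (hc : 0 < c)
    (hk₀ : n ≤ 2 * k₀) (hk₀L : k₀ + L ≤ n + 1)
    (hzw : ‖Complex.exp ((t / n : ℝ) * Complex.I) ^ q - 1‖ ≤ z)
    (hzu : ‖Complex.exp ((s / n : ℝ) * Complex.I) ^ q - 1‖ ≤ z)
    (hqz : (q : ℝ) ≤ z * n)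
    (hsep : ∀ k l : ℤ, |k| ≤ q → |l| ≤ q → ¬ (k = 0 ∧ l = 0) →
      ρ ≤ ‖Complex.exp ((k * (s / n) + l * (t / n) : ℝ) * Complex.I) - 1‖)
    (hH : 12 / ρ ≤ H) (hHL : 2 * ((m + 1) * (q * H)) ≤ L)
    (hsmall : 2 * (m + 2) * z ^ (m + 1) * ‖x‖ ≤ 1 / 4)
    (hLn : 2 * (2 ^ (m + 1) * (m + 2)) * (L / n : ℝ) ≤ (1 / 2) ^ (m + 1) / 8)
    (hx : c ≤ ‖x‖) (hη : 2 ^ (m + 1) * η ≤ 1 / 4) (hηc : 2 ^ (m + 1) * η ≤ (1 / 2) ^ (m + 1) * c / 8)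
    (hη0 : 0 ≤ η) :
    ∃ j < L, η < ‖wave n s t x (k₀ + j) -
      GaussianInt.toComplex (gaussRound (wave n s t x (k₀ + j)))‖ := by
  by_contra! hcon
  have hn' : (0 : ℝ) < n := by exact_mod_cast hn
  have hH0 : 0 < H := by
    have : (0 : ℝ) < H := lt_of_lt_of_le (by positivity) hH
    exact_mod_cast this
  have hqZ : (1 : ℤ) ≤ q := by exact_mod_cast hq
  obtain ⟨l, hl, hl1, hl2⟩ := exists_separating_multiple (q * (t / n)) (q * (s / n)) ρ hρ
    (by simpa using hsep 0 q (by simp) (by simp) (by simp; omega))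
    (by simpa using hsep q 0 (by simp) (by simp) (by simp; omega))
    (by simpa [add_comm] using hsep q q (by simp) (by simp) (by simp; omega))
    (by simpa [add_comm, sub_eq_add_neg] using hsep (-q) q (by simp) (by simp) (by simp; omega))
    H hH
  have hwu : ρ ≤ ‖Complex.exp ((t / n : ℝ) * Complex.I) - Complex.exp ((s / n : ℝ) * Complex.I)‖ := by
    have h1 := hsep (-1) 1 (by simpa using hqZ) (by simpa using hqZ) (by simp)
    rw [norm_exp_sub_exp]
    convert h1 using 6
    push_cast; ring
  have hpw : ∀ r : ℝ, Complex.exp ((q * r : ℝ) * Complex.I) ^ l =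
      Complex.exp ((r : ℝ) * Complex.I) ^ (q * l) := by
    intro r
    rw [pow_mul, ← Complex.exp_nat_mul _ q]
    push_cast
    rw [mul_assoc]
  rw [hpw] at hl1 hl2
  have hw := Complex.norm_exp_ofReal_mul_I (t / n)
  have hu := Complex.norm_exp_ofReal_mul_I (s / n)
  have hb1 : ‖((x 1 / n : ℝ) : ℂ) * Complex.I‖ * n ≤ ‖x‖ := by
    rw [norm_amplitude_slope _ _ hn]; exact abs_coord_le x 1
  have hb3 : ‖((x 3 / n : ℝ) : ℂ) * Complex.I‖ * n ≤ ‖x‖ := by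
    rw [norm_amplitude_slope _ _ hn]; exact abs_coord_le x 3
  have hx2 := norm_sq_eq_four x
  have ha0 : ∀ k ≤ n, ‖(x 0 : ℂ) + ((x 1 / n : ℝ) * Complex.I) * k‖ ≤ ‖x‖ := fun k hk =>
    amplitude_le n k hn hk _ _ _ (norm_nonneg _) (by nlinarith [sq_nonneg (x 2), sq_nonneg (x 3)])
  have ha2 : ∀ k ≤ n, ‖(x 2 : ℂ) + ((x 3 / n : ℝ) * Complex.I) * k‖ ≤ ‖x‖ := fun k hk =>
    amplitude_le n k hn hk _ _ _ (norm_nonneg _) (by nlinarith [sq_nonneg (x 0), sq_nonneg (x 1)])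
  have hwave : wave n s t x = fun k : ℕ =>
    ((x 0 : ℂ) + ((x 1 / n : ℝ) * Complex.I) * k) * Complex.exp ((t / n : ℝ) * Complex.I) ^ k +
    ((x 2 : ℂ) + ((x 3 / n : ℝ) * Complex.I) * k) * Complex.exp ((s / n : ℝ) * Complex.I) ^ k := rfl
  -- all differences of step `q ℓ` of order `m + 1` starting in a window of length `L - T ≥ L / 2`
  -- stay in the block
  have hT1 : (m + 1) * q ≤ (m + 1) * (q * H) :=
    Nat.mul_le_mul_left _ (Nat.le_mul_of_pos_right _ hH0)
  have hT2 : (m + 1) * (q * l) + (m + 1) * q ≤ (m + 1) * (q * H) := by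
    have : (m + 1) * (q * l) + (m + 1) * q = (m + 1) * (q * (l + 1)) := by ring
    rw [this]
    exact Nat.mul_le_mul_left _ (Nat.mul_le_mul_left _ hl)
  have hHT : H ≤ (m + 1) * (q * H) := by
    calc H = 1 * (1 * H) := by ring
      _ ≤ _ := Nat.mul_le_mul (by omega) (Nat.mul_le_mul_right _ hq)
  have hT0 : 0 < (m + 1) * q := by positivity
  have hql : q * l ≤ (m + 1) * (q * l) := Nat.le_mul_of_pos_left _ (by omega)
  generalize hT : (m + 1) * (q * H) = T at hT1 hT2 hHT hHL
  have hup : ∀ j < L - T, ‖(fwdDiff (q * l))^[m + 1] (wave n s t x) (k₀ + j)‖ ≤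
      2 ^ (m + 1) * η := by
    intro j hj
    refine norm_fwdDiff_iter_mul_step_le (wave n s t x) (m + 1) q l k₀ L η ?_ hη ?_ _ (by omega)
      (by omega)
    · intro k h1 h2
      have := hcon (k - k₀) (by omega)
      rwa [show k₀ + (k - k₀) = k by omega] at this
    · intro k h1 h2
      rw [hwave, fwdDiff_iter_add_apply]
      have e1 := norm_fwdDiff_iter_small _ _ _ hw m q n k ‖x‖ z hzw hqz hb1 (ha0 k (by omega))
      have e2 := norm_fwdDiff_iter_small _ _ _ hu m q n k ‖x‖ z hzu hqz hb3 (ha2 k (by omega))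
      refine (norm_add_le _ _).trans ?_
      linarith
  have hHW : (H : ℝ) ≤ (L - T : ℕ) := by
    have : H ≤ L - T := by omega
    exact_mod_cast this
  have hlow := sum_norm_sq_fwdDiff_ge n hn _ _ _ _ _ _ hw hu
    (by intro h; rw [h, sub_self, norm_zero] at hwu; linarith) m (q * l) k₀ L (L - T) ‖x‖
    (norm_nonneg x) (by omega) (by omega) hl1 hl2 hb1 hb3 (amplitude_sq_lower n k₀ hn hk₀ x) hLn ?_
  · rw [← hwave] at hlow
    have hW0 : (0 : ℝ) < (L - T : ℕ) := lt_of_lt_of_le (by exact_mod_cast hH0) hHW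
    have hsum : ∑ j ∈ Finset.range (L - T),
        ‖(fwdDiff (q * l))^[m + 1] (wave n s t x) (k₀ + j)‖ ^ 2 ≤
        (L - T : ℕ) * (2 ^ (m + 1) * η) ^ 2 := by
      calc _ ≤ ∑ j ∈ Finset.range (L - T), (2 ^ (m + 1) * η) ^ 2 := by
            refine Finset.sum_le_sum fun j hj => ?_
            have := hup j (Finset.mem_range.1 hj)
            gcongr
        _ = _ := by simp
    have h1 := le_of_mul_le_mul_left (hlow.trans hsum) hW0
    have hη2 : (2 ^ (m + 1) * η) ^ 2 ≤ ((1 / 2) ^ (m + 1) * ‖x‖ / 8) ^ 2 := by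
      have : 2 ^ (m + 1) * η ≤ (1 / 2) ^ (m + 1) * ‖x‖ / 8 := hηc.trans (by gcongr)
      gcongr
    have hpos : 0 < ((1 / 2) ^ (m + 1) * ‖x‖ / 8) ^ 2 := by
      have : 0 < ‖x‖ := hc.trans_le hx
      positivity
    linarith
  · calc _ ≤ 4 / ρ := by gcongr
      _ ≤ 12 / ρ := by gcongr; norm_num
      _ ≤ _ := hH.trans hHW

/-! ### Summation over blocks and choice of the scales -/

/-- Disjoint blocks of length `L` fill the second half of `{1, …, n}`. -/
lemma mul_le_sum_of_blocks (f : ℕ → ℝ) (hf : ∀ k, 0 ≤ f k) (n L : ℕ) (β : ℝ) (hβ : 0 ≤ β)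
    (hL : 0 < L) (hLn : 4 * L ≤ n)
    (h : ∀ k₀, n ≤ 2 * k₀ → k₀ + L ≤ n + 1 → β ≤ ∑ j ∈ Finset.range L, f (k₀ + j)) :
    (n : ℝ) / (4 * L) * β ≤ ∑ k ∈ Finset.range n, f (k + 1) := by
  have key : ∀ J : ℕ, 2 * (J * L) ≤ n →
      J * β ≤ ∑ k ∈ Finset.Ico (n - J * L) n, f (k + 1) := by
    intro J
    induction J with
    | zero => intro _; simp
    | succ J ih =>
      intro hJ
      rw [add_mul, one_mul] at hJ
      have h1 := ih (by omega)
      have h2 := h (n - (J + 1) * L + 1) (by rw [add_mul, one_mul]; omega)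
        (by rw [add_mul, one_mul]; omega)
      rw [← Finset.sum_Ico_consecutive _ (show n - (J + 1) * L ≤ n - J * L by
        rw [add_mul, one_mul]; omega) (Nat.sub_le _ _)]
      have h3 : ∑ k ∈ Finset.Ico (n - (J + 1) * L) (n - J * L), f (k + 1) =
          ∑ j ∈ Finset.range L, f (n - (J + 1) * L + 1 + j) := by
        rw [Finset.sum_Ico_eq_sum_range]
        have : n - J * L - (n - (J + 1) * L) = L := by rw [add_mul, one_mul]; omega
        rw [this]
        exact Finset.sum_congr rfl fun j _ => by congr 1; ring
      rw [h3]
      push_cast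
      linarith
  have hL' : (0 : ℝ) < L := by exact_mod_cast hL
  have hdiv : 2 * (n / (2 * L) * L) ≤ n := by
    have := Nat.div_mul_le_self n (2 * L)
    calc 2 * (n / (2 * L) * L) = n / (2 * L) * (2 * L) := by ring
      _ ≤ n := this
  have h1 := key (n / (2 * L)) hdiv
  have h2 : (n : ℝ) / (4 * L) ≤ (n / (2 * L) : ℕ) := by
    have h3 : (n : ℝ) / (2 * L : ℕ) < (n / (2 * L) : ℕ) + 1 := by
      rw [div_lt_iff₀ (by positivity)]
      rw [mul_comm]
      exact_mod_cast Nat.lt_mul_div_succ n (show 0 < 2 * L by omega)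
    have h4 : (1 : ℝ) ≤ n / (4 * L) := by
      rw [le_div_iff₀ (by positivity), one_mul]; exact_mod_cast hLn
    have h5 : (n : ℝ) / (2 * L : ℕ) = 2 * (n / (4 * L)) := by push_cast; field_simp; norm_num
    linarith
  refine (mul_le_mul_of_nonneg_right h2 hβ).trans (h1.trans ?_)
  refine Finset.sum_le_sum_of_subset_of_nonneg ?_ fun k _ _ => hf _
  intro k hk
  exact Finset.mem_range.2 (Finset.mem_Ico.1 hk).2

/-- The non-approximability condition in multiplicative form. -/
lemma JointCondition.separation {τ : ℝ} {n : ℕ} {s t : ℝ} (h : JointCondition τ n s t)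
    (k l : ℤ) (hk : |(k : ℝ)| ≤ (n : ℝ) ^ τ) (hl : |(l : ℝ)| ≤ (n : ℝ) ^ τ)
    (hkl : ¬ (k = 0 ∧ l = 0)) :
    2 * (n : ℝ) ^ (-1 + 8 * τ) ≤
      ‖Complex.exp ((k * (s / n) + l * (t / n) : ℝ) * Complex.I) - 1‖ := by
  refine le_trans ?_ (two_mul_distInt_le_norm _)
  have h1 := h.2.2
  push Not at h1
  have h2 := h1 k l hk hl (by tauto)
  have e : (k * (s / n) + l * (t / n) : ℝ) / Real.pi =
      k * (s / (Real.pi * n)) + l * (t / (Real.pi * n)) := by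
    rw [add_div, mul_div_assoc, mul_div_assoc, div_div, div_div, mul_comm Real.pi]
  rw [e]
  linarith

lemma eventually_le_rpow (K : ℝ) {r : ℝ} (hr : 0 < r) :
    ∀ᶠ n : ℕ in Filter.atTop, K ≤ (n : ℝ) ^ r :=
  ((tendsto_rpow_atTop hr).comp tendsto_natCast_atTop_atTop).eventually_ge_atTop K

lemma half_le_floor {x : ℝ} (hx : 1 ≤ x) : x / 2 ≤ (⌊x⌋₊ : ℝ) := by
  have h1 := Nat.lt_floor_add_one x
  have h2 : (1 : ℝ) ≤ ⌊x⌋₊ := by exact_mod_cast Nat.floor_pos.2 hx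
  linarith

lemma eventually_block {τ : ℝ} (hτ : 0 < τ) (hτ' : τ < 1 / 16) :
    ∀ᶠ n : ℕ in Filter.atTop, 0 < n ∧ 0 < ⌊(n : ℝ) ^ (1 - τ)⌋₊ ∧
      (n : ℝ) ^ (1 - τ) / 2 ≤ (⌊(n : ℝ) ^ (1 - τ)⌋₊ : ℝ) ∧
      (⌊(n : ℝ) ^ (1 - τ)⌋₊ : ℝ) * (n : ℝ) ^ τ ≤ n ∧ 16 * ⌊(n : ℝ) ^ (1 - τ)⌋₊ ≤ n := by
  filter_upwards [eventually_le_rpow 16 hτ, Filter.eventually_ge_atTop 1] with n h1 hn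
  have hn' : (1 : ℝ) ≤ n := by exact_mod_cast hn
  have h2 : (1 : ℝ) ≤ (n : ℝ) ^ (1 - τ) := Real.one_le_rpow hn' (by linarith)
  have h3 : (⌊(n : ℝ) ^ (1 - τ)⌋₊ : ℝ) * (n : ℝ) ^ τ ≤ n := by
    calc _ ≤ (n : ℝ) ^ (1 - τ) * (n : ℝ) ^ τ := by
          gcongr; exact Nat.floor_le (by positivity)
      _ = n := by rw [← Real.rpow_add (by linarith)]; simp
  refine ⟨hn, Nat.floor_pos.2 h2, half_le_floor h2, h3, ?_⟩
  have : (16 : ℝ) * ⌊(n : ℝ) ^ (1 - τ)⌋₊ ≤ n := by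
    refine le_trans ?_ h3
    rw [mul_comm]
    gcongr
  exact_mod_cast this

/-- The wave has mean square of order `‖x‖ ^ 2` over `{1, …, n}`, since the condition keeps the two
frequencies apart. -/
lemma sum_norm_sq_wave_ge {τ : ℝ} (hτ : 0 < τ) (hτ' : τ < 1 / 16) :
    ∀ᶠ n : ℕ in Filter.atTop, ∀ s t, JointCondition τ n s t → ∀ x : EuclideanSpace ℝ (Fin 4),
      n * ‖x‖ ^ 2 / 128 ≤ ∑ k ∈ Finset.range n, ‖wave n s t x (k + 1)‖ ^ 2 := by
  filter_upwards [eventually_block hτ hτ', eventually_le_rpow 4 (show 0 < 7 * τ by linarith)]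
    with n ⟨hn, hL0, hL1, hL2, hL3⟩ h7 s t hst x
  have hn' : (1 : ℝ) ≤ n := by exact_mod_cast hn
  set L := ⌊(n : ℝ) ^ (1 - τ)⌋₊
  have hsep := hst.separation (-1) 1 (by simpa using Real.one_le_rpow hn' hτ.le)
    (by simpa using Real.one_le_rpow hn' hτ.le) (by simp)
  have hwu : 2 * (n : ℝ) ^ (-1 + 8 * τ) ≤
      ‖Complex.exp ((t / n : ℝ) * Complex.I) - Complex.exp ((s / n : ℝ) * Complex.I)‖ := by
    rw [norm_exp_sub_exp]
    convert hsep using 6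
    push_cast; ring
  have hρ : 0 < 2 * (n : ℝ) ^ (-1 + 8 * τ) := by positivity
  have hbeat : 4 / ‖Complex.exp ((t / n : ℝ) * Complex.I) -
      Complex.exp ((s / n : ℝ) * Complex.I)‖ ≤ L := by
    calc _ ≤ 4 / (2 * (n : ℝ) ^ (-1 + 8 * τ)) := by gcongr
      _ = 4 * (n : ℝ) ^ (1 - 8 * τ) / 2 := by
        rw [show (1 - 8 * τ) = -(-1 + 8 * τ) by ring, Real.rpow_neg (by linarith)]
        field_simp
      _ ≤ (n : ℝ) ^ (7 * τ) * (n : ℝ) ^ (1 - 8 * τ) / 2 := by gcongr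
      _ = (n : ℝ) ^ (1 - τ) / 2 := by rw [← Real.rpow_add (by linarith)]; ring_nf
      _ ≤ _ := hL1
  have hL' : (0 : ℝ) < L := by exact_mod_cast hL0
  have := mul_le_sum_of_blocks (fun k => ‖wave n s t x k‖ ^ 2) (fun _ => by positivity) n L
    (L * (‖x‖ ^ 2 / 32)) (by positivity) hL0 (by omega) fun k₀ hk₀ hk₀L =>
      sum_norm_sq_wave_block n hn s t x L k₀ hk₀ hL3
        (by intro h; rw [h, sub_self, norm_zero] at hwu; linarith) hbeat
  refine le_trans (le_of_eq ?_) this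
  field_simp
  ring

/-- For amplitudes between a constant and any fixed power of `n`, the values of the wave are at a
polynomially large total squared distance from the Gaussian integers: each of the about `n ^ τ`
blocks of length `n ^ (1 - τ)` contributes at least a constant. -/
lemma sum_distInt_wave_ge {τ : ℝ} (hτ : 0 < τ) (hτ' : τ < 1 / 16) (D : ℝ) {c : ℝ} (hc : 0 < c) :
    ∃ η > 0, ∀ᶠ n : ℕ in Filter.atTop, ∀ s t, JointCondition τ n s t →
      ∀ x : EuclideanSpace ℝ (Fin 4), c ≤ ‖x‖ → ‖x‖ ≤ (n : ℝ) ^ D →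
      η * (n : ℝ) ^ τ ≤ ∑ k ∈ Finset.range n,
        (distInt (wave n s t x (k + 1)).re ^ 2 + distInt (wave n s t x (k + 1)).im ^ 2) := by
  -- the number of differences: each gains a factor `n ^ (-τ / 3)` against the size `n ^ D`
  obtain ⟨m, hm⟩ := exists_nat_ge ((D + 1) * (3 / τ))
  set η : ℝ := min (1 / 4) ((1 / 2) ^ (m + 1) * c / 8) / 2 ^ (m + 1) with hη
  have hη0 : 0 < η := by positivity
  have hη1 : 2 ^ (m + 1) * η = min (1 / 4) ((1 / 2) ^ (m + 1) * c / 8) := by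
    rw [hη]; field_simp
  refine ⟨η ^ 2 / 4, by positivity, ?_⟩
  filter_upwards [eventually_block hτ hτ', eventually_le_rpow 1 (show 0 < τ / 3 by linarith),
    eventually_le_rpow (28 * (m + 1)) (show 0 < 6 * τ by linarith),
    eventually_le_rpow (2 * (m + 2) * (4 * Real.pi) ^ (m + 1) * 4) one_pos,
    eventually_le_rpow (2 * (2 ^ (m + 1) * (m + 2)) * (8 / (1 / 2) ^ (m + 1))) hτ]
    with n ⟨hn, hL0, hL1, hL2, hL3⟩ h1 h6 hsm hLτ s t hst x hcx hxD
  have hn' : (1 : ℝ) ≤ n := by exact_mod_cast hn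
  have hn0 : (0 : ℝ) < n := by linarith
  set L := ⌊(n : ℝ) ^ (1 - τ)⌋₊
  -- simultaneous approximation of quality `1 / N` costs a multiplier up to `N ^ 3 ≤ n ^ τ`
  set N := ⌊(n : ℝ) ^ (τ / 3)⌋₊
  have hN0 : 0 < N := Nat.floor_pos.2 h1
  have hN1 : (n : ℝ) ^ (τ / 3) / 2 ≤ N := half_le_floor h1
  have hN2 : (N : ℝ) ≤ (n : ℝ) ^ (τ / 3) := Nat.floor_le (by positivity)
  have hN0' : (0 : ℝ) < N := by exact_mod_cast hN0
  have hN3 : (N : ℝ) ^ 3 ≤ (n : ℝ) ^ τ := by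
    calc (N : ℝ) ^ 3 ≤ ((n : ℝ) ^ (τ / 3)) ^ 3 := by gcongr
      _ = (n : ℝ) ^ τ := by rw [← Real.rpow_natCast, ← Real.rpow_mul hn0.le]; push_cast; congr 1; ring
  obtain ⟨q, hq0, hqN, hqt, hqs⟩ := exists_simultaneous_return (t / n) (s / n) N hN0
  have hqτ : (q : ℝ) ≤ (n : ℝ) ^ τ := by
    refine le_trans ?_ hN3
    exact_mod_cast hqN
  set H := L / (2 * (m + 1) * N ^ 3) with hH
  set ρ := 2 * (n : ℝ) ^ (-1 + 8 * τ) with hρ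
  have hρ0 : 0 < ρ := by positivity
  have hL' : (0 : ℝ) < L := by exact_mod_cast hL0
  have hHL : 2 * ((m + 1) * (q * H)) ≤ L := by
    calc 2 * ((m + 1) * (q * H)) ≤ 2 * ((m + 1) * (N ^ 3 * H)) := by gcongr
      _ = L / (2 * (m + 1) * N ^ 3) * (2 * (m + 1) * N ^ 3) := by rw [← hH]; ring
      _ ≤ L := Nat.div_mul_le_self _ _
  have hHρ : 12 / ρ ≤ H := by
    have e1 : 12 / ρ = 6 * (n : ℝ) ^ (1 - 8 * τ) := by
      rw [hρ, show (1 - 8 * τ) = -(-1 + 8 * τ) by ring, Real.rpow_neg hn0.le]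
      field_simp; norm_num
    have e2 : (L : ℝ) < (H + 1) * (2 * (m + 1) * N ^ 3) := by
      have : L < (H + 1) * (2 * (m + 1) * N ^ 3) := by
        rw [mul_comm]; exact Nat.lt_mul_div_succ L (by positivity)
      exact_mod_cast this
    have e3 : (1 : ℝ) ≤ (n : ℝ) ^ (1 - 8 * τ) := Real.one_le_rpow hn' (by linarith)
    have e4 : (n : ℝ) ^ (1 - τ) = (n : ℝ) ^ (6 * τ) * (n : ℝ) ^ (1 - 8 * τ) * (n : ℝ) ^ τ := by
      rw [← Real.rpow_add hn0, ← Real.rpow_add hn0]; congr 1; ring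
    have e5 : 28 * (m + 1) * (n : ℝ) ^ (1 - 8 * τ) * (n : ℝ) ^ τ ≤ 2 * L := by
      have : 28 * (m + 1) * (n : ℝ) ^ (1 - 8 * τ) * (n : ℝ) ^ τ ≤ (n : ℝ) ^ (1 - τ) := by
        rw [e4]; gcongr
      linarith
    have e6 : (L : ℝ) < (H + 1) * (2 * (m + 1) * (n : ℝ) ^ τ) := e2.trans_le (by gcongr)
    have e7 : 7 * (n : ℝ) ^ (1 - 8 * τ) * (4 * (m + 1) * (n : ℝ) ^ τ) <
        (H + 1) * (4 * (m + 1) * (n : ℝ) ^ τ) := by linarith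
    have e8 := lt_of_mul_lt_mul_right e7 (by positivity)
    rw [e1]
    linarith
  have hz : 2 * Real.pi / N ≤ 4 * Real.pi / (n : ℝ) ^ (τ / 3) := by
    rw [div_le_div_iff₀ hN0' (by positivity)]
    nlinarith [Real.pi_pos]
  have hqz : (q : ℝ) ≤ 2 * Real.pi / N * n := by
    have e1 : (1 : ℝ) ≤ 2 * Real.pi := by linarith [Real.pi_gt_three]
    calc (q : ℝ) ≤ (n : ℝ) ^ τ := hqτ
      _ ≤ (n : ℝ) ^ (1 - τ / 3) := Real.rpow_le_rpow_of_exponent_le hn' (by linarith)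
      _ = 1 / (n : ℝ) ^ (τ / 3) * n := by
        rw [Real.rpow_sub hn0, Real.rpow_one]; field_simp
      _ ≤ 2 * Real.pi / N * n := by gcongr
  have hsmall : 2 * (m + 2) * (2 * Real.pi / N) ^ (m + 1) * ‖x‖ ≤ 1 / 4 := by
    have e1 : ((n : ℝ) ^ (τ / 3)) ^ (m + 1) = (n : ℝ) ^ (τ / 3 * (m + 1)) := by
      rw [← Real.rpow_natCast, ← Real.rpow_mul hn0.le]; push_cast; rfl
    have e2 : D + 1 ≤ τ / 3 * (m + 1) := by
      have : (D + 1) * (3 / τ) * (τ / 3) ≤ m * (τ / 3) := by gcongr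
      have e : (D + 1) * (3 / τ) * (τ / 3) = D + 1 := by field_simp
      nlinarith
    have e3 : (n : ℝ) ^ D * n ≤ ((n : ℝ) ^ (τ / 3)) ^ (m + 1) := by
      rw [e1]
      calc (n : ℝ) ^ D * n = (n : ℝ) ^ (D + 1) := by rw [Real.rpow_add hn0, Real.rpow_one]
        _ ≤ _ := Real.rpow_le_rpow_of_exponent_le hn' e2
    rw [Real.rpow_one] at hsm
    have e4 : ‖x‖ / ((n : ℝ) ^ (τ / 3)) ^ (m + 1) ≤ 1 / n := by
      rw [div_le_div_iff₀ (by positivity) hn0, one_mul]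
      exact le_trans (by gcongr) e3
    calc _ ≤ 2 * (m + 2) * (4 * Real.pi / (n : ℝ) ^ (τ / 3)) ^ (m + 1) * ‖x‖ := by gcongr
      _ = 2 * (m + 2) * (4 * Real.pi) ^ (m + 1) * (‖x‖ / ((n : ℝ) ^ (τ / 3)) ^ (m + 1)) := by
        rw [div_pow]; ring
      _ ≤ 2 * (m + 2) * (4 * Real.pi) ^ (m + 1) * (1 / n) := by gcongr
      _ ≤ 1 / 4 := by rw [mul_one_div, div_le_div_iff₀ hn0 (by norm_num)]; linarith
  have hLn : 2 * (2 ^ (m + 1) * (m + 2)) * (L / n : ℝ) ≤ (1 / 2) ^ (m + 1) / 8 := by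
    have e1 : (L / n : ℝ) ≤ 1 / (n : ℝ) ^ τ := by
      rw [div_le_div_iff₀ hn0 (by positivity), one_mul]; exact hL2
    calc _ ≤ 2 * (2 ^ (m + 1) * (m + 2)) * (1 / (n : ℝ) ^ τ) := by gcongr
      _ ≤ _ := by
        rw [mul_one_div, div_le_div_iff₀ (by positivity) (by norm_num)]
        rw [mul_div_assoc', div_le_iff₀ (by positivity)] at hLτ
        linarith
  have := mul_le_sum_of_blocks (fun k => distInt (wave n s t x k).re ^ 2 +
      distInt (wave n s t x k).im ^ 2) (fun _ => by positivity) n L (η ^ 2) (by positivity) hL0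
      (by omega) ?_
  · refine le_trans ?_ this
    have e1 : (n : ℝ) ^ τ ≤ n / L := by
      rw [le_div_iff₀ hL', mul_comm]; exact hL2
    calc η ^ 2 / 4 * (n : ℝ) ^ τ ≤ η ^ 2 / 4 * (n / L) := by gcongr
      _ = _ := by field_simp
  · intro k₀ hk₀ hk₀L
    obtain ⟨j, hj, hjη⟩ := exists_far_from_gaussianInt n hn s t x m q H L k₀ (2 * Real.pi / N) ρ c η
      hq0 hρ0 hc hk₀ hk₀L hqt hqs hqz
      (fun k l hk hl hkl => hst.separation k l
        (le_trans (by exact_mod_cast hk) hqτ) (le_trans (by exact_mod_cast hl) hqτ) hkl)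
      hHρ hHL hsmall hLn hcx (by rw [hη1]; exact min_le_left _ _)
      (by rw [hη1]; exact min_le_right _ _) hη0.le
    calc η ^ 2 ≤ ‖wave n s t x (k₀ + j) -
        GaussianInt.toComplex (gaussRound (wave n s t x (k₀ + j)))‖ ^ 2 := by gcongr
      _ = _ := norm_sub_gaussRound_sq _
      _ ≤ _ := Finset.single_le_sum (f := fun j => distInt (wave n s t x (k₀ + j)).re ^ 2 +
          distInt (wave n s t x (k₀ + j)).im ^ 2) (fun _ _ => by positivity)
          (Finset.mem_range.2 hj)

/-! ### Small balls and characteristic functions -/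

section Esseen

variable {E : Type*} [NormedAddCommGroup E] [InnerProductSpace ℝ E] [FiniteDimensional ℝ E]
  [MeasurableSpace E] [BorelSpace E]

lemma integral_ball_sub_le (F : E → ℝ) (hF : Continuous F) (hF0 : ∀ x, 0 ≤ F x) (r : ℝ) (t' : E)
    (ht' : t' ∈ Metric.ball (0 : E) r) :
    ∫ t in Metric.ball (0 : E) r, F (t - t') ≤ ∫ x in Metric.ball (0 : E) (2 * r), F x := by
  rw [← integral_indicator Metric.isOpen_ball.measurableSet,
    ← integral_indicator Metric.isOpen_ball.measurableSet,
    ← integral_add_right_eq_self _ t']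
  have hint : Integrable ((Metric.ball (0 : E) (2 * r)).indicator F) := by
    rw [integrable_indicator_iff Metric.isOpen_ball.measurableSet]
    exact (hF.continuousOn.integrableOn_compact (isCompact_closedBall 0 (2 * r))).mono_set
      Metric.ball_subset_closedBall
  refine integral_mono_of_nonneg (Filter.Eventually.of_forall fun x =>
    Set.indicator_nonneg (fun _ _ => hF0 _) _) hint (Filter.Eventually.of_forall fun x => ?_)
  by_cases hx : x + t' ∈ Metric.ball (0 : E) r
  · have hx2 : x ∈ Metric.ball (0 : E) (2 * r) := by
      rw [mem_ball_zero_iff] at *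
      have := norm_sub_le (x + t') t'
      rw [add_sub_cancel_right] at this
      linarith
    simp [Set.indicator_of_mem hx, Set.indicator_of_mem hx2]
  · simp only [Set.indicator_of_notMem hx]
    exact Set.indicator_nonneg (fun _ _ => hF0 _) _

/-- Esseen's inequality: the mass of a ball of radius `1 / r` is controlled by the integral of the
characteristic function over the ball of radius `2 r`. The test function is the squared modulus of
the Fourier transform of the ball of radius `r`, which is nonnegative and bounded below on the dual
ball, and whose Fourier transform is supported in the ball of radius `2 r`. -/
lemma measureReal_ball_mul_volume_le (μ : Measure E) [IsProbabilityMeasure μ] (a : E) {r : ℝ}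
    (hr : 0 < r) :
    μ.real (Metric.ball a (1 / r)) * volume.real (Metric.ball (0 : E) r) ≤
      4 * ∫ x in Metric.ball (0 : E) (2 * r), ‖charFun μ x‖ := by
  set U := Metric.ball (0 : E) r with hU
  set V := volume.real U with hV
  set ν := volume.restrict U with hν
  have hfin : volume U < ⊤ := measure_ball_lt_top
  have : IsFiniteMeasure ν := ⟨by rw [hν, Measure.restrict_apply_univ]; exact hfin⟩
  have hV0 : 0 < V := ENNReal.toReal_pos (Metric.measure_ball_pos _ _ hr).ne' hfin.ne
  set e : E → E → ℂ := fun y t => Complex.exp ((inner ℝ (y - a) t : ℝ) * Complex.I) with he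
  have henorm : ∀ y t, ‖e y t‖ = 1 := fun y t => Complex.norm_exp_ofReal_mul_I _
  set g : E → ℂ := fun y => ∫ t, e y t ∂ν with hg
  have hlow : ∀ y ∈ Metric.ball a (1 / r), V ^ 2 / 4 ≤ ‖g y‖ ^ 2 := by
    intro y hy
    have hi : Integrable (fun t => e y t) ν :=
      (integrable_const (1 : ℝ)).mono' (by
        have : Continuous fun t => e y t := by simp only [he]; fun_prop
        exact this.aestronglyMeasurable) (Filter.Eventually.of_forall fun t => (henorm y t).le)
    have h1 : V / 2 ≤ (g y).re := by
      have h2 : (g y).re = ∫ t, (e y t).re ∂ν :=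
        (integral_re (𝕜 := ℂ) hi).symm
      rw [h2]
      have h3 : V / 2 = ∫ _t, (1 / 2 : ℝ) ∂ν := by
        simp [hν, hV]; ring
      rw [h3]
      refine integral_mono_ae (integrable_const _) hi.re ?_
      filter_upwards [ae_restrict_mem Metric.isOpen_ball.measurableSet] with t ht
      have h4 : |inner ℝ (y - a) t| ≤ 1 := by
        refine (abs_real_inner_le_norm _ _).trans ?_
        rw [mem_ball_iff_norm] at hy
        rw [mem_ball_zero_iff] at ht
        calc ‖y - a‖ * ‖t‖ ≤ (1 / r) * r := by gcongr
          _ = 1 := by field_simp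
      have h5 := Real.one_sub_sq_div_two_le_cos (x := inner ℝ (y - a) t)
      have h6 : (inner ℝ (y - a) t) ^ 2 ≤ 1 := by
        rw [← sq_abs]; nlinarith [abs_nonneg (inner ℝ (y - a) t : ℝ)]
      show (1 / 2 : ℝ) ≤ (Complex.exp ((inner ℝ (y - a) t : ℝ) * Complex.I)).re
      rw [Complex.exp_ofReal_mul_I_re]
      linarith
    have h7 : V / 2 ≤ ‖g y‖ := h1.trans (Complex.re_le_norm _)
    nlinarith
  have hsq : ∀ y, ((‖g y‖ ^ 2 : ℝ) : ℂ) = ∫ p : E × E, e y (p.1 - p.2) ∂(ν.prod ν) := by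
    intro y
    have h1 : ((‖g y‖ ^ 2 : ℝ) : ℂ) = g y * (starRingEnd ℂ) (g y) := by
      rw [Complex.mul_conj, Complex.normSq_eq_norm_sq]
    rw [h1, hg]
    simp only []
    rw [← integral_conj, ← integral_prod_mul]
    refine integral_congr_ae (Filter.Eventually.of_forall fun p => ?_)
    simp only [he]
    rw [← Complex.exp_conj, ← Complex.exp_add, inner_sub_right]
    simp only [map_mul, Complex.conj_ofReal, Complex.conj_I]
    congr 1; push_cast; ring
  have hswap : ∫ y, ((‖g y‖ ^ 2 : ℝ) : ℂ) ∂μ =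
      ∫ p : E × E, ∫ y, e y (p.1 - p.2) ∂μ ∂(ν.prod ν) := by
    simp_rw [hsq]
    refine integral_integral_swap ?_
    refine (integrable_const (1 : ℝ)).mono' ?_ (Filter.Eventually.of_forall fun p => (henorm _ _).le)
    have : Continuous (Function.uncurry fun (y : E) (p : E × E) => e y (p.1 - p.2)) := by
      simp only [he, Function.uncurry_def]; fun_prop
    exact this.aestronglyMeasurable
  have hchar : ∀ t, ‖∫ y, e y t ∂μ‖ = ‖charFun μ t‖ := by
    intro t
    rw [charFun_apply]
    have : ∀ y, e y t = Complex.exp ((inner ℝ y t : ℝ) * Complex.I) *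
        Complex.exp ((-inner ℝ a t : ℝ) * Complex.I) := by
      intro y
      simp only [he]
      rw [← Complex.exp_add, inner_sub_left]
      congr 1; push_cast; ring
    simp_rw [this]
    rw [integral_mul_const, norm_mul, Complex.norm_exp_ofReal_mul_I, mul_one]
  have hcont : Continuous fun x => ‖charFun μ x‖ := continuous_charFun.norm
  have hint : Integrable (fun p : E × E => ‖charFun μ (p.1 - p.2)‖) (ν.prod ν) :=
    (integrable_const (1 : ℝ)).mono' (by
      have : Continuous fun p : E × E => ‖charFun μ (p.1 - p.2)‖ :=
        hcont.comp (continuous_fst.sub continuous_snd)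
      exact this.aestronglyMeasurable) (Filter.Eventually.of_forall fun p => by
        rw [norm_norm]; exact norm_charFun_le_one _)
  have hup : ∫ y, ‖g y‖ ^ 2 ∂μ ≤ V * ∫ x in Metric.ball (0 : E) (2 * r), ‖charFun μ x‖ := by
    have h1 : ∫ y, ‖g y‖ ^ 2 ∂μ ≤ ‖∫ y, ((‖g y‖ ^ 2 : ℝ) : ℂ) ∂μ‖ := by
      have h2 : ((∫ y, ‖g y‖ ^ 2 ∂μ : ℝ) : ℂ) = ∫ y, ((‖g y‖ ^ 2 : ℝ) : ℂ) ∂μ :=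
        integral_ofReal.symm
      rw [← h2, Complex.norm_real]
      exact le_abs_self _
    refine h1.trans ?_
    rw [hswap]
    refine (norm_integral_le_integral_norm _).trans ?_
    simp_rw [hchar]
    rw [integral_prod_symm _ hint]
    calc _ ≤ ∫ _t', (∫ x in Metric.ball (0 : E) (2 * r), ‖charFun μ x‖) ∂ν := by
          refine integral_mono_ae hint.integral_prod_right (integrable_const _) ?_
          filter_upwards [ae_restrict_mem Metric.isOpen_ball.measurableSet] with t' ht'
          exact integral_ball_sub_le _ hcont (fun _ => norm_nonneg _) r t' ht'
      _ = _ := by simp [hν, hV]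
  have hgcont : Continuous g := by
    refine continuous_of_dominated (bound := fun _ => (1 : ℝ)) (fun y => ?_)
      (fun y => Filter.Eventually.of_forall fun t => (henorm y t).le) (integrable_const _)
      (Filter.Eventually.of_forall fun t => ?_)
    · have : Continuous fun t => e y t := by simp only [he]; fun_prop
      exact this.aestronglyMeasurable
    · simp only [he]; fun_prop
  have hgint : Integrable (fun y => ‖g y‖ ^ 2) μ := by
    refine (integrable_const (V ^ 2)).mono' (hgcont.norm.pow 2).aestronglyMeasurable
      (Filter.Eventually.of_forall fun y => ?_)
    rw [norm_pow, norm_norm]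
    have : ‖g y‖ ≤ V := by
      refine (norm_integral_le_integral_norm _).trans (le_of_eq ?_)
      simp [henorm, hν, hV]
    gcongr
  have hmk := mul_meas_ge_le_integral_of_nonneg (μ := μ)
    (Filter.Eventually.of_forall fun y => sq_nonneg ‖g y‖) hgint (V ^ 2 / 4)
  have hsub : μ.real (Metric.ball a (1 / r)) ≤ μ.real {y | V ^ 2 / 4 ≤ ‖g y‖ ^ 2} :=
    measureReal_mono hlow
  have h1 : V ^ 2 / 4 * μ.real (Metric.ball a (1 / r)) ≤
      V * ∫ x in Metric.ball (0 : E) (2 * r), ‖charFun μ x‖ :=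
    (mul_le_mul_of_nonneg_left hsub (by positivity)).trans (hmk.trans hup)
  have h2 : V * (μ.real (Metric.ball a (1 / r)) * V) ≤
      V * (4 * ∫ x in Metric.ball (0 : E) (2 * r), ‖charFun μ x‖) := by linarith
  exact le_of_mul_le_mul_left h2 hV0

end Esseen

/-! ### Decay of products of characteristic functions -/

lemma one_sub_norm_charFun_sq (μ : Measure ℝ) [IsProbabilityMeasure μ] (u : ℝ) :
    1 - ‖charFun μ u‖ ^ 2 = ∫ p : ℝ × ℝ, (1 - Real.cos (u * (p.1 - p.2))) ∂(μ.prod μ) := by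
  have h1 : ((‖charFun μ u‖ ^ 2 : ℝ) : ℂ) =
      ∫ p : ℝ × ℝ, Complex.exp ((u * (p.1 - p.2) : ℝ) * Complex.I) ∂(μ.prod μ) := by
    have h2 : ((‖charFun μ u‖ ^ 2 : ℝ) : ℂ) = charFun μ u * (starRingEnd ℂ) (charFun μ u) := by
      rw [Complex.mul_conj, Complex.normSq_eq_norm_sq]
    rw [h2, charFun_apply_real, ← integral_conj, ← integral_prod_mul]
    refine integral_congr_ae (Filter.Eventually.of_forall fun p => ?_)
    simp only
    rw [← Complex.exp_conj, ← Complex.exp_add]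
    simp only [map_mul, Complex.conj_ofReal, Complex.conj_I]
    congr 1; push_cast; ring
  have hi : Integrable (fun p : ℝ × ℝ => Complex.exp ((u * (p.1 - p.2) : ℝ) * Complex.I))
      (μ.prod μ) := (integrable_const (1 : ℝ)).mono' (by
        have : Continuous fun p : ℝ × ℝ => Complex.exp ((u * (p.1 - p.2) : ℝ) * Complex.I) := by
          fun_prop
        exact this.aestronglyMeasurable)
        (Filter.Eventually.of_forall fun p => (Complex.norm_exp_ofReal_mul_I _).le)
  have h3 : ‖charFun μ u‖ ^ 2 = ∫ p : ℝ × ℝ, Real.cos (u * (p.1 - p.2)) ∂(μ.prod μ) := by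
    have h4 := congrArg Complex.re h1
    rw [Complex.ofReal_re] at h4
    rw [h4]
    refine ((integral_re (𝕜 := ℂ) hi).symm).trans ?_
    exact integral_congr_ae (Filter.Eventually.of_forall fun p => Complex.exp_ofReal_mul_I_re _)
  have hi' : Integrable (fun p : ℝ × ℝ => Real.cos (u * (p.1 - p.2))) (μ.prod μ) :=
    hi.re.congr (Filter.Eventually.of_forall fun p => Complex.exp_ofReal_mul_I_re _)
  rw [integral_sub (integrable_const _) hi', h3]
  simp

lemma integrable_one_sub_cos (μ : Measure ℝ) [IsProbabilityMeasure μ] (u : ℝ) :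
    Integrable (fun p : ℝ × ℝ => 1 - Real.cos (u * (p.1 - p.2))) (μ.prod μ) :=
  (integrable_const (2 : ℝ)).mono' (by
    have : Continuous fun p : ℝ × ℝ => 1 - Real.cos (u * (p.1 - p.2)) := by fun_prop
    exact this.aestronglyMeasurable) (Filter.Eventually.of_forall fun p => by
      rw [Real.norm_eq_abs, abs_le]
      constructor <;>
      linarith [Real.cos_le_one (u * (p.1 - p.2)), Real.neg_one_le_cos (u * (p.1 - p.2))])

/-- The pairs whose difference has modulus in `[1, R]`. -/
def annulus (R : ℝ) : Set (ℝ × ℝ) := {p | 1 ≤ |p.1 - p.2| ∧ |p.1 - p.2| ≤ R}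

lemma measurableSet_annulus (R : ℝ) : MeasurableSet (annulus R) := by
  have : Continuous fun p : ℝ × ℝ => |p.1 - p.2| := by fun_prop
  exact (measurableSet_le measurable_const this.measurable).inter
    (measurableSet_le this.measurable measurable_const)

/-- By symmetrization, a product of characteristic functions is small as soon as
`∑ (1 - cos (u_i w))` is large for all `w` of modulus in `[1, R]`. -/
lemma prod_norm_charFun_le {ι : Type*} [Fintype ι] (μ : Measure ℝ) [IsProbabilityMeasure μ]
    (u : ι → ℝ) (R B : ℝ)
    (h : ∀ w : ℝ, 1 ≤ |w| → |w| ≤ R → B ≤ ∑ i, (1 - Real.cos (u i * w))) :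
    ∏ i, ‖charFun μ (u i)‖ ≤ Real.exp (-((μ.prod μ).real (annulus R) * B / 2)) := by
  have h1 : (μ.prod μ).real (annulus R) * B ≤ ∑ i, (1 - ‖charFun μ (u i)‖ ^ 2) := by
    simp_rw [one_sub_norm_charFun_sq]
    rw [← integral_finsetSum _ fun i _ => integrable_one_sub_cos μ (u i)]
    have h2 : (μ.prod μ).real (annulus R) * B =
        ∫ p, (annulus R).indicator (fun _ => B) p ∂(μ.prod μ) := by
      rw [integral_indicator_const _ (measurableSet_annulus R), smul_eq_mul]
    rw [h2]
    refine integral_mono ((integrable_const B).indicator (measurableSet_annulus R))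
      (integrable_finsetSum _ fun i _ => integrable_one_sub_cos μ (u i)) fun p => ?_
    by_cases hp : p ∈ annulus R
    · rw [Set.indicator_of_mem hp]
      exact h _ hp.1 hp.2
    · rw [Set.indicator_of_notMem hp]
      exact Finset.sum_nonneg fun i _ => by linarith [Real.cos_le_one (u i * (p.1 - p.2))]
  have h3 : ∀ i, ‖charFun μ (u i)‖ ≤ Real.exp (-((1 - ‖charFun μ (u i)‖ ^ 2) / 2)) := by
    intro i
    refine le_of_sq_le_sq ?_ (Real.exp_pos _).le
    rw [← Real.exp_nat_mul]
    have := Real.add_one_le_exp (‖charFun μ (u i)‖ ^ 2 - 1)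
    refine le_trans (by linarith) (this.trans (le_of_eq ?_))
    congr 1; push_cast; ring
  calc ∏ i, ‖charFun μ (u i)‖ ≤ ∏ i, Real.exp (-((1 - ‖charFun μ (u i)‖ ^ 2) / 2)) :=
        Finset.prod_le_prod (fun _ _ => norm_nonneg _) fun i _ => h3 i
    _ = Real.exp (-((∑ i, (1 - ‖charFun μ (u i)‖ ^ 2)) / 2)) := by
        rw [← Real.exp_sum, Finset.sum_neg_distrib, Finset.sum_div]
    _ ≤ _ := by
        rw [Real.exp_le_exp]; linarith

/-- Two independent copies of a normalized variable with a bounded moment of order `2 + ε` differ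
by an amount of order one with probability bounded below. -/
lemma exists_annulus_mass (ε : ℝ) (hε : 0 < ε) (M : ℝ) :
    ∃ R ≥ 1, ∃ c > 0, ∀ (μ : Measure ℝ) [IsProbabilityMeasure μ],
      Integrable (fun x : ℝ => |x| ^ (2 + ε)) μ → ∫ x, |x| ^ (2 + ε) ∂μ ≤ M →
      ∫ x, x ∂μ = 0 → ∫ x, x ^ 2 ∂μ = 1 → c ≤ (μ.prod μ).real (annulus R) := by
  obtain ⟨R, hR⟩ := ((tendsto_rpow_atTop hε).eventually_ge_atTop
    (4 * 2 ^ (2 + ε) * M)).and (Filter.eventually_ge_atTop (1 : ℝ)) |>.exists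
  have hR0 : 0 < R := lt_of_lt_of_le one_pos hR.2
  refine ⟨R, hR.2, 1 / (2 * R ^ 2), by positivity, ?_⟩
  intro μ _ hint hM hmean hvar
  -- otherwise the integral of the square would be zero by convention
  have hint2 : Integrable (fun x : ℝ => x ^ 2) μ := by
    by_contra hcon
    rw [integral_undef hcon] at hvar
    exact zero_ne_one hvar
  have hint1 : Integrable (fun x : ℝ => x) μ := by
    refine ((integrable_const (1 : ℝ)).add hint2).mono' measurable_id.aestronglyMeasurable
      (Filter.Eventually.of_forall fun x => ?_)
    simp only [Pi.add_apply, Real.norm_eq_abs]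
    nlinarith [sq_abs x, sq_nonneg (|x| - 1)]
  -- pointwise splitting of the square of the difference
  have hpt : ∀ p : ℝ × ℝ, (p.1 - p.2) ^ 2 ≤ 1 + (annulus R).indicator (fun _ => R ^ 2) p +
      2 ^ (2 + ε) / R ^ ε * (|p.1| ^ (2 + ε) + |p.2| ^ (2 + ε)) := by
    intro p
    have hnn : 0 ≤ 2 ^ (2 + ε) / R ^ ε * (|p.1| ^ (2 + ε) + |p.2| ^ (2 + ε)) := by positivity
    have hi0 : 0 ≤ (annulus R).indicator (fun _ => R ^ 2) p :=
      Set.indicator_nonneg (fun _ _ => by positivity) _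
    rw [← sq_abs]
    rcases lt_or_ge |p.1 - p.2| 1 with h1 | h1
    · nlinarith [abs_nonneg (p.1 - p.2)]
    rcases le_or_gt |p.1 - p.2| R with h2 | h2
    · rw [Set.indicator_of_mem (show p ∈ annulus R from ⟨h1, h2⟩)]
      nlinarith [abs_nonneg (p.1 - p.2)]
    · have hpos : 0 < |p.1 - p.2| := by linarith
      have h3 : |p.1 - p.2| ^ 2 * R ^ ε ≤ |p.1 - p.2| ^ (2 + ε) := by
        rw [Real.rpow_add hpos, Real.rpow_two]
        gcongr
      have h4 : |p.1 - p.2| ^ (2 + ε) ≤ 2 ^ (2 + ε) * (|p.1| ^ (2 + ε) + |p.2| ^ (2 + ε)) := by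
        have h5 : |p.1 - p.2| ≤ 2 * max |p.1| |p.2| := by
          have := abs_sub p.1 p.2
          linarith [le_max_left |p.1| |p.2|, le_max_right |p.1| |p.2|]
        calc |p.1 - p.2| ^ (2 + ε) ≤ (2 * max |p.1| |p.2|) ^ (2 + ε) := by gcongr
          _ = 2 ^ (2 + ε) * (max |p.1| |p.2|) ^ (2 + ε) := by
            rw [Real.mul_rpow (by norm_num) (by positivity)]
          _ ≤ _ := by
            gcongr
            rcases max_choice |p.1| |p.2| with h | h <;> rw [h]
            · exact le_add_of_nonneg_right (by positivity)
            · exact le_add_of_nonneg_left (by positivity)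
      have h6 : |p.1 - p.2| ^ 2 ≤ 2 ^ (2 + ε) / R ^ ε * (|p.1| ^ (2 + ε) + |p.2| ^ (2 + ε)) := by
        rw [div_mul_eq_mul_div, le_div_iff₀ (by positivity)]
        exact h3.trans h4
      linarith
  have hsq : ∫ p : ℝ × ℝ, (p.1 - p.2) ^ 2 ∂(μ.prod μ) = 2 := by
    have e : ∀ p : ℝ × ℝ, (p.1 - p.2) ^ 2 = (p.1 ^ 2 + p.2 ^ 2) - 2 * (p.1 * p.2) := by
      intro p; ring
    have hadd : Integrable (fun p : ℝ × ℝ => p.1 ^ 2 + p.2 ^ 2) (μ.prod μ) :=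
      (hint2.comp_fst μ).add (hint2.comp_snd μ)
    simp_rw [e]
    rw [integral_sub hadd ((hint1.mul_prod hint1).const_mul 2),
      integral_add (hint2.comp_fst μ) (hint2.comp_snd μ), integral_const_mul,
      integral_prod_mul (fun x : ℝ => x) (fun x : ℝ => x), hmean, integral_fun_fst (fun x : ℝ => x ^ 2),
      integral_fun_snd (fun x : ℝ => x ^ 2), hvar]
    simp
    norm_num
  have hI2 : Integrable ((annulus R).indicator (fun _ => R ^ 2)) (μ.prod μ) :=
    (integrable_const _).indicator (measurableSet_annulus R)
  have hI3 : Integrable (fun p : ℝ × ℝ => 2 ^ (2 + ε) / R ^ ε *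
      (|p.1| ^ (2 + ε) + |p.2| ^ (2 + ε))) (μ.prod μ) :=
    ((hint.comp_fst μ).add (hint.comp_snd μ)).const_mul _
  have hle : ∫ p : ℝ × ℝ, (p.1 - p.2) ^ 2 ∂(μ.prod μ) ≤
      ∫ p : ℝ × ℝ, (1 + (annulus R).indicator (fun _ => R ^ 2) p +
      2 ^ (2 + ε) / R ^ ε * (|p.1| ^ (2 + ε) + |p.2| ^ (2 + ε))) ∂(μ.prod μ) :=
    integral_mono_of_nonneg (Filter.Eventually.of_forall fun p => sq_nonneg _)
      (((integrable_const _).add hI2).add hI3) (Filter.Eventually.of_forall hpt)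
  have hI1 : Integrable (fun p => 1 + (annulus R).indicator (fun _ => R ^ 2) p) (μ.prod μ) :=
    (integrable_const _).add hI2
  rw [hsq, integral_add hI1 hI3, integral_add (integrable_const _) hI2,
    integral_indicator_const _ (measurableSet_annulus R), integral_const_mul,
    integral_add (hint.comp_fst μ) (hint.comp_snd μ),
    integral_fun_fst (fun x : ℝ => |x| ^ (2 + ε)), integral_fun_snd (fun x : ℝ => |x| ^ (2 + ε))] at hle
  simp only [integral_const, probReal_univ, smul_eq_mul, one_mul] at hle
  have htail : 2 ^ (2 + ε) / R ^ ε * (∫ x, |x| ^ (2 + ε) ∂μ + ∫ x, |x| ^ (2 + ε) ∂μ) ≤ 1 / 2 := by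
    calc _ ≤ 2 ^ (2 + ε) / R ^ ε * (M + M) := by gcongr
      _ ≤ 1 / 2 := by
        rw [div_mul_eq_mul_div, div_le_div_iff₀ (by positivity) (by norm_num)]
        linarith [hR.1]
  rw [div_le_iff₀ (by positivity)]
  linarith

/-! ### The characteristic function of the walk -/

lemma wave_re (n : ℕ) (s t : ℝ) (x : EuclideanSpace ℝ (Fin 4)) (k : ℕ) :
    (wave n s t x k).re = inner ℝ (v n k s t) x := by
  rw [PiLp.inner_apply, Fin.sum_univ_four]
  simp only [wave, ← Complex.exp_nat_mul]
  rw [show (k : ℂ) * ((t / n : ℝ) * Complex.I) = ((k * t / n : ℝ) : ℂ) * Complex.I by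
      push_cast; ring,
    show (k : ℂ) * ((s / n : ℝ) * Complex.I) = ((k * s / n : ℝ) : ℂ) * Complex.I by
      push_cast; ring]
  simp [v, -Complex.ofReal_mul, -Complex.ofReal_div, Complex.exp_ofReal_mul_I_re,
    Complex.exp_ofReal_mul_I_im]
  ring

lemma wave_im (n : ℕ) (s t : ℝ) (x : EuclideanSpace ℝ (Fin 4)) (k : ℕ) :
    (wave n s t x k).im = inner ℝ (v' n k s t) x := by
  rw [PiLp.inner_apply, Fin.sum_univ_four]
  simp only [wave, ← Complex.exp_nat_mul]
  rw [show (k : ℂ) * ((t / n : ℝ) * Complex.I) = ((k * t / n : ℝ) : ℂ) * Complex.I by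
      push_cast; ring,
    show (k : ℂ) * ((s / n : ℝ) * Complex.I) = ((k * s / n : ℝ) : ℂ) * Complex.I by
      push_cast; ring]
  simp [v', -Complex.ofReal_mul, -Complex.ofReal_div, Complex.exp_ofReal_mul_I_re,
    Complex.exp_ofReal_mul_I_im]
  ring

lemma wave_smul (n : ℕ) (s t c : ℝ) (x : EuclideanSpace ℝ (Fin 4)) (k : ℕ) :
    wave n s t (c • x) k = c * wave n s t x k := by
  simp only [wave, PiLp.smul_apply, smul_eq_mul]
  push_cast
  ring

lemma norm_wave_le (n : ℕ) (hn : 0 < n) (s t : ℝ) (x : EuclideanSpace ℝ (Fin 4)) (k : ℕ)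
    (hk : k ≤ n) : ‖wave n s t x k‖ ≤ 2 * ‖x‖ := by
  have hx2 := norm_sq_eq_four x
  have h1 := amplitude_le n k hn hk (x 0) (x 1) ‖x‖ (norm_nonneg _)
    (by nlinarith [sq_nonneg (x 2), sq_nonneg (x 3)])
  have h2 := amplitude_le n k hn hk (x 2) (x 3) ‖x‖ (norm_nonneg _)
    (by nlinarith [sq_nonneg (x 0), sq_nonneg (x 1)])
  refine (norm_add_le _ _).trans ?_
  rw [norm_mul, norm_mul _ (_ ^ _), norm_pow, norm_pow, Complex.norm_exp_ofReal_mul_I,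
    Complex.norm_exp_ofReal_mul_I, one_pow, mul_one, mul_one]
  linarith

/-- The vectors multiplying the coefficients of the walk. -/
noncomputable def stepVector (n : ℕ) (s t : ℝ) (p : Fin n × Fin 2) : EuclideanSpace ℝ (Fin 4) :=
  ![v n ((p.1 : ℕ) + 1) s t, v' n ((p.1 : ℕ) + 1) s t] p.2

lemma S_eq_sum (n : ℕ) (s t : ℝ) (Y : Fin n → Fin 2 → ℝ) :
    S n s t Y = ∑ p : Fin n × Fin 2, Y p.1 p.2 • stepVector n s t p := by
  rw [S, Fintype.sum_prod_type]
  exact Finset.sum_congr rfl fun i _ => by rw [Fin.sum_univ_two]; rfl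

/-- By independence, the characteristic function of the rescaled walk is the product of those of its
steps. -/
lemma charFun_walk {Ω : Type*} [MeasurableSpace Ω] {P : Measure Ω} {n : ℕ}
    {y : Fin n → Fin 2 → Ω → ℝ} {μ : Measure ℝ} (hy : iIndepFun (fun p : Fin n × Fin 2 => y p.1 p.2) P)
    (hm : ∀ i j, AEMeasurable (y i j) P) (hμ : ∀ i j, P.map (y i j) = μ) (s t : ℝ)
    (x : EuclideanSpace ℝ (Fin 4)) :
    charFun (P.map fun ω => (1 / Real.sqrt n) • S n s t (fun i j => y i j ω)) x =
      ∏ p : Fin n × Fin 2, charFun μ (inner ℝ (stepVector n s t p) x / Real.sqrt n) := by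
  set g : Fin n × Fin 2 → ℝ → EuclideanSpace ℝ (Fin 4) :=
    fun p r => (1 / Real.sqrt n) • r • stepVector n s t p with hg
  have hgm : ∀ p, Measurable (g p) := fun p => by
    have : Continuous (g p) := by simp only [hg]; fun_prop
    exact this.measurable
  have h1 : (fun ω => (1 / Real.sqrt n) • S n s t (fun i j => y i j ω)) =
      fun ω => ∑ p : Fin n × Fin 2, (g p ∘ y p.1 p.2) ω := by
    funext ω
    rw [S_eq_sum, Finset.smul_sum]
    rfl
  rw [h1, iIndepFun.charFun_map_fun_sum_eq_prod
    (fun p => (hgm p).comp_aemeasurable (hm p.1 p.2)) (hy.comp g hgm), Finset.prod_apply]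
  refine Finset.prod_congr rfl fun p _ => ?_
  rw [← AEMeasurable.map_map_of_aemeasurable (hgm p).aemeasurable (hm p.1 p.2), hμ,
    charFun_apply, charFun_apply_real, integral_map (hgm p).aemeasurable (by
      have : Continuous fun z : EuclideanSpace ℝ (Fin 4) =>
        Complex.exp ((inner ℝ z x : ℝ) * Complex.I) := by fun_prop
      exact this.aestronglyMeasurable)]
  refine integral_congr_ae (Filter.Eventually.of_forall fun r => ?_)
  simp only [hg, inner_smul_left]
  congr 1
  push_cast
  simp
  ring

lemma sum_stepVector (n : ℕ) (s t : ℝ) (x : EuclideanSpace ℝ (Fin 4)) (F : ℝ → ℝ) :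
    ∑ p : Fin n × Fin 2, F (inner ℝ (stepVector n s t p) x) =
      ∑ k ∈ Finset.range n, (F (wave n s t x (k + 1)).re + F (wave n s t x (k + 1)).im) := by
  rw [Fintype.sum_prod_type, ← Fin.sum_univ_eq_sum_range
    (fun k => F (wave n s t x (k + 1)).re + F (wave n s t x (k + 1)).im)]
  refine Finset.sum_congr rfl fun i _ => ?_
  rw [Fin.sum_univ_two, wave_re, wave_im]
  rfl

lemma eight_mul_distInt_sq_le (y : ℝ) : 8 * distInt y ^ 2 ≤ 1 - Real.cos (2 * Real.pi * y) := by
  set d := y - round y with hd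
  have h1 : Real.cos (2 * Real.pi * y) = Real.cos (2 * Real.pi * d) := by
    have : 2 * Real.pi * y = 2 * Real.pi * d + (round y : ℤ) * (2 * Real.pi) := by rw [hd]; ring
    rw [this, Real.cos_add_int_mul_two_pi]
  have hd2 : |d| ≤ 1 / 2 := abs_sub_round y
  have h2 := Real.cos_le_one_sub_mul_cos_sq (x := 2 * Real.pi * d) (by
    rw [abs_mul, abs_of_pos Real.two_pi_pos]; nlinarith [Real.pi_pos])
  have h3 : 2 / Real.pi ^ 2 * (2 * Real.pi * d) ^ 2 = 8 * d ^ 2 := by field_simp; ring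
  have h4 : distInt y ^ 2 = d ^ 2 := by rw [distInt, sq_abs]
  rw [h1, h4]
  linarith

/-- The exponent in the bound for the characteristic function of the walk: it is quadratic for
frequencies up to `√n / R`, and at least a power of `n` from there to a fixed power of `n`. -/
lemma sum_one_sub_cos_ge {τ : ℝ} (hτ : 0 < τ) (hτ' : τ < 1 / 16) (C : ℝ) {R : ℝ}
    (hR : 1 ≤ R) :
    ∃ κ > 0, ∀ᶠ n : ℕ in Filter.atTop, ∀ s t, JointCondition τ n s t →
      ∀ x : EuclideanSpace ℝ (Fin 4), ‖x‖ ≤ 2 * (n : ℝ) ^ C → ∀ w : ℝ, 1 ≤ |w| → |w| ≤ R →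
      min (‖x‖ ^ 2 / 1024) (κ * (n : ℝ) ^ τ) ≤
        ∑ p : Fin n × Fin 2,
          (1 - Real.cos (inner ℝ (stepVector n s t p) x / Real.sqrt n * w)) := by
  obtain ⟨η, hη, hev⟩ := sum_distInt_wave_ge hτ hτ' (C + 1)
    (show 0 < 1 / (2 * Real.pi * R) by positivity)
  refine ⟨8 * η, by positivity, ?_⟩
  filter_upwards [hev, sum_norm_sq_wave_ge hτ hτ', Filter.eventually_ge_atTop 1,
    eventually_le_rpow R one_pos] with n hfar hL2 hn hnR s t hst x hx w hw1 hwR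
  have hn0 : (0 : ℝ) < n := by exact_mod_cast hn
  have hn1 : (1 : ℝ) ≤ n := by exact_mod_cast hn
  rw [Real.rpow_one] at hnR
  have hsn : 0 < Real.sqrt n := Real.sqrt_pos.2 hn0
  have hsq : Real.sqrt n ^ 2 = n := Real.sq_sqrt hn0.le
  have hR0 : 0 < R := by linarith
  rw [sum_stepVector n s t x (fun r => 1 - Real.cos (r / Real.sqrt n * w))]
  rcases le_or_gt ‖x‖ (Real.sqrt n / R) with hxs | hxl
  · refine (min_le_left _ _).trans ?_
    have hquad : ∀ r : ℝ, |r| ≤ 2 * ‖x‖ → r ^ 2 / (8 * n) ≤ 1 - Real.cos (r / Real.sqrt n * w) := by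
      intro r hr
      have h1 : |r / Real.sqrt n * w| ≤ Real.pi := by
        rw [abs_mul, abs_div, abs_of_pos hsn]
        calc |r| / Real.sqrt n * |w| ≤ 2 * (Real.sqrt n / R) / Real.sqrt n * R := by
              gcongr; linarith
          _ = 2 := by field_simp
          _ ≤ Real.pi := Real.two_le_pi
      have h2 := Real.cos_le_one_sub_mul_cos_sq h1
      have h3 : (1 : ℝ) / 8 ≤ 2 / Real.pi ^ 2 := by
        rw [div_le_div_iff₀ (by norm_num) (by positivity)]
        nlinarith [Real.pi_le_four, Real.pi_pos]
      have h4 : r ^ 2 / n ≤ (r / Real.sqrt n * w) ^ 2 := by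
        rw [mul_pow, div_pow, hsq]
        have : 1 ≤ w ^ 2 := by rw [← sq_abs]; nlinarith
        exact le_mul_of_one_le_right (by positivity) this
      have h5 : r ^ 2 / (8 * n) = 1 / 8 * (r ^ 2 / n) := by field_simp
      have h6 : 1 / 8 * (r ^ 2 / n) ≤ 2 / Real.pi ^ 2 * (r / Real.sqrt n * w) ^ 2 := by gcongr
      linarith
    have h1 := hL2 s t hst x
    calc ‖x‖ ^ 2 / 1024 = (n * ‖x‖ ^ 2 / 128) / (8 * n) := by field_simp; ring
      _ ≤ (∑ k ∈ Finset.range n, ‖wave n s t x (k + 1)‖ ^ 2) / (8 * n) := by gcongr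
      _ ≤ _ := by
        rw [Finset.sum_div]
        refine Finset.sum_le_sum fun k hk => ?_
        have hb := norm_wave_le n hn s t x (k + 1) (Finset.mem_range.1 hk)
        have e1 := hquad _ ((Complex.abs_re_le_norm _).trans hb)
        have e2 := hquad _ ((Complex.abs_im_le_norm _).trans hb)
        have e3 : ‖wave n s t x (k + 1)‖ ^ 2 / (8 * n) = (wave n s t x (k + 1)).re ^ 2 / (8 * n) +
            (wave n s t x (k + 1)).im ^ 2 / (8 * n) := by
          rw [Complex.sq_norm, Complex.normSq_apply]; ring
        rw [e3]
        exact add_le_add e1 e2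
  · refine (min_le_right _ _).trans ?_
    set c := w / (2 * Real.pi * Real.sqrt n) with hc
    have hnorm : ‖c • x‖ = |w| * ‖x‖ / (2 * Real.pi * Real.sqrt n) := by
      rw [norm_smul, hc, Real.norm_eq_abs, abs_div,
        abs_of_pos (show 0 < 2 * Real.pi * Real.sqrt n by positivity)]
      ring
    have hlow : 1 / (2 * Real.pi * R) ≤ ‖c • x‖ := by
      rw [hnorm]
      calc 1 / (2 * Real.pi * R) = 1 * (Real.sqrt n / R) / (2 * Real.pi * Real.sqrt n) := by
            field_simp
        _ ≤ _ := by gcongr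
    have hup : ‖c • x‖ ≤ (n : ℝ) ^ (C + 1) := by
      have hs1 : 1 ≤ Real.sqrt n := Real.one_le_sqrt.2 hn1
      have h2 : 2 ≤ 2 * Real.pi * Real.sqrt n := by nlinarith [Real.two_le_pi]
      rw [hnorm]
      calc _ ≤ R * (2 * (n : ℝ) ^ C) / 2 := by gcongr
        _ = R * (n : ℝ) ^ C := by ring
        _ ≤ n * (n : ℝ) ^ C := by gcongr
        _ = _ := by rw [Real.rpow_add hn0, Real.rpow_one, mul_comm]
    have h1 := hfar s t hst (c • x) hlow hup
    have h2 : 8 * η * (n : ℝ) ^ τ = 8 * (η * (n : ℝ) ^ τ) := by ring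
    rw [h2]
    refine (mul_le_mul_of_nonneg_left h1 (by norm_num : (0 : ℝ) ≤ 8)).trans ?_
    rw [Finset.mul_sum]
    refine Finset.sum_le_sum fun k _ => ?_
    rw [wave_smul, Complex.re_ofReal_mul, Complex.im_ofReal_mul, mul_add]
    have h3 : ∀ r : ℝ, 2 * Real.pi * (c * r) = r / Real.sqrt n * w := by
      intro r; rw [hc]; field_simp
    have e1 := eight_mul_distInt_sq_le (c * (wave n s t x (k + 1)).re)
    have e2 := eight_mul_distInt_sq_le (c * (wave n s t x (k + 1)).im)
    rw [h3] at e1 e2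
    exact add_le_add e1 e2

lemma integrable_exp_neg_mul_norm_sq {c : ℝ} (hc : 0 < c) :
    Integrable (fun x : EuclideanSpace ℝ (Fin 4) => Real.exp (-(c * ‖x‖ ^ 2))) := by
  have h := (GaussianFourier.integrable_cexp_neg_mul_sq_norm_add (V := EuclideanSpace ℝ (Fin 4))
    (b := c) (by simpa using hc) 0 0).norm
  refine h.congr (Filter.Eventually.of_forall fun x => ?_)
  simp only [Complex.norm_exp]
  congr 1
  simp [← Complex.ofReal_pow]

lemma eventually_exp_neg_mul_rpow_le {κ τ C : ℝ} (hκ : 0 < κ) (hτ : 0 < τ) :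
    ∀ᶠ n : ℕ in Filter.atTop, Real.exp (-(κ * (n : ℝ) ^ τ)) ≤ (n : ℝ) ^ (-C) := by
  have h1 := (isLittleO_exp_neg_mul_rpow_atTop hκ (-C / τ)).bound one_pos
  have h2 := ((tendsto_rpow_atTop hτ).comp tendsto_natCast_atTop_atTop).eventually h1
  filter_upwards [h2] with n hn
  simp only [Function.comp, one_mul, Real.norm_eq_abs, Real.abs_exp] at hn
  rw [abs_of_nonneg (by positivity), ← Real.rpow_mul (by positivity)] at hn
  rw [← neg_mul]
  refine hn.trans (le_of_eq ?_)
  congr 1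
  field_simp

end TrigWalk

open TrigWalk

theorem theorem2p3 :
    ∃ τ₀ : ℝ, 0 < τ₀ ∧ ∀ τ : ℝ, 0 < τ → τ < τ₀ →
    ∀ C : ℝ, 0 < C → ∀ ε₀ : ℝ, 0 < ε₀ → ∀ M : ℝ,
    ∃ K : ℝ,
    -- a random variable with mean zero, variance one and bounded moment of order `2 + ε₀`
    ∀ (Ω' : Type*) [MeasurableSpace Ω'] (P' : Measure Ω') [IsProbabilityMeasure P'] (ξ : Ω' → ℝ),
      AEMeasurable ξ P' →
      Integrable (fun ω => |ξ ω| ^ (2 + ε₀)) P' →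
      ∫ ω, |ξ ω| ^ (2 + ε₀) ∂P' ≤ M →
      ∫ ω, ξ ω ∂P' = 0 →
      variance ξ P' = 1 →
    ∀ n : ℕ, 1 ≤ n →
    -- independent copies of it
    ∀ (Ω : Type*) [MeasurableSpace Ω] (P : Measure Ω) [IsProbabilityMeasure P]
      (y : Fin n → Fin 2 → Ω → ℝ),
      iIndepFun (fun p : Fin n × Fin 2 => y p.1 p.2) P →
      (∀ i j, IdentDistrib (y i j) ξ P P') →
    ∀ s t : ℝ, TrigWalk.JointCondition τ n s t →
    ∀ (a : EuclideanSpace ℝ (Fin 4)) (δ : ℝ), δ = (n : ℝ) ^ (-C) →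
      P.real {ω | (1 / Real.sqrt n) • TrigWalk.S n s t (fun i j => y i j ω) ∈ Metric.ball a δ}
        ≤ K * δ ^ 4 := by
  refine ⟨1 / 16, by norm_num, ?_⟩
  intro τ hτ hτ' C hC ε₀ hε₀ M
  obtain ⟨R, hR, c₀, hc₀, hmass⟩ := exists_annulus_mass ε₀ hε₀ M
  obtain ⟨κ, hκ, hexp⟩ := sum_one_sub_cos_ge hτ hτ' C hR
  obtain ⟨n₀, hn₀⟩ := Filter.eventually_atTop.1 (hexp.and
    (eventually_exp_neg_mul_rpow_le (κ := c₀ * κ / 2) (C := 4 * C) (by positivity) hτ))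
  set G := ∫ x : EuclideanSpace ℝ (Fin 4), Real.exp (-(c₀ / 2048 * ‖x‖ ^ 2)) with hG
  set V := volume.real (Metric.ball (0 : EuclideanSpace ℝ (Fin 4)) 1) with hV
  have hV0 : 0 < V :=
    ENNReal.toReal_pos (Metric.measure_ball_pos _ _ one_pos).ne' measure_ball_lt_top.ne
  have hG0 : 0 ≤ G := integral_nonneg fun x => (Real.exp_pos _).le
  refine ⟨4 * (G + 16 * V) / V + ((n₀ : ℝ) ^ C) ^ 4, ?_⟩
  intro Ω' _ P' _ ξ hξ hint hM hmean hvar n hn Ω _ P _ y hy hident s t hst a δ hδ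
  have hn0 : (0 : ℝ) < n := by exact_mod_cast hn
  have hδ0 : 0 < δ := by rw [hδ]; positivity
  have hδn : δ * (n : ℝ) ^ C = 1 := by
    rw [hδ, ← Real.rpow_add hn0]; simp
  rcases lt_or_ge n n₀ with hlt | hge
  · -- the finitely many small values of `n`
    have h1 : (1 : ℝ) ≤ ((n₀ : ℝ) ^ C * δ) ^ 4 := by
      refine one_le_pow₀ ?_
      rw [← hδn, mul_comm]
      gcongr
    rw [mul_pow] at h1
    have h2 : 0 ≤ 4 * (G + 16 * V) / V * δ ^ 4 := by positivity
    calc _ ≤ (1 : ℝ) := measureReal_le_one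
      _ ≤ _ := by rw [add_mul]; linarith
  obtain ⟨hcos, hexpn⟩ := hn₀ n hge
  -- the law of the coefficients
  set μ := P'.map ξ with hμ
  have : IsProbabilityMeasure μ := Measure.isProbabilityMeasure_map hξ
  have hpow : Measurable fun x : ℝ => |x| ^ (2 + ε₀) := by fun_prop
  have hmassμ : c₀ ≤ (μ.prod μ).real (annulus R) := by
    refine hmass μ ?_ ?_ ?_ ?_
    · exact (integrable_map_measure hpow.aestronglyMeasurable hξ).2 hint
    · rw [hμ, integral_map hξ hpow.aestronglyMeasurable]; exact hM
    · rw [hμ, integral_map hξ (by fun_prop : Measurable fun x : ℝ => x).aestronglyMeasurable]; exact hmean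
    · rw [hμ, integral_map hξ (by fun_prop : Measurable fun x : ℝ => x ^ 2).aestronglyMeasurable,
        ← variance_of_integral_eq_zero hξ hmean]
      exact hvar
  have hym : ∀ i j, AEMeasurable (y i j) P := fun i j => (hident i j).aemeasurable_fst
  have hyμ : ∀ i j, P.map (y i j) = μ := fun i j => (hident i j).map_eq
  -- the law of the walk
  set X : Ω → EuclideanSpace ℝ (Fin 4) :=
    fun ω => (1 / Real.sqrt n) • S n s t (fun i j => y i j ω) with hX
  have hXm : AEMeasurable X P := by
    simp only [hX, S_eq_sum]
    have hsum : AEMeasurable (fun ω => ∑ p : Fin n × Fin 2, y p.1 p.2 ω • stepVector n s t p) P :=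
      Finset.aemeasurable_fun_sum _ fun p _ => (hym p.1 p.2).smul_const _
    exact hsum.const_smul (1 / Real.sqrt n)
  have : IsProbabilityMeasure (P.map X) := Measure.isProbabilityMeasure_map hXm
  have hchar : ∀ x ∈ Metric.ball (0 : EuclideanSpace ℝ (Fin 4)) (2 * (n : ℝ) ^ C),
      ‖charFun (P.map X) x‖ ≤ Real.exp (-(c₀ / 2048 * ‖x‖ ^ 2)) + (n : ℝ) ^ (-(4 * C)) := by
    intro x hx
    rw [mem_ball_zero_iff] at hx
    rw [hX, charFun_walk hy hym hyμ, norm_prod]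
    refine (prod_norm_charFun_le μ _ R _ (hcos s t hst x hx.le)).trans ?_
    have h1 : Real.exp (-((μ.prod μ).real (annulus R) *
        min (‖x‖ ^ 2 / 1024) (κ * (n : ℝ) ^ τ) / 2)) ≤
        Real.exp (-(c₀ * min (‖x‖ ^ 2 / 1024) (κ * (n : ℝ) ^ τ) / 2)) := by
      have : 0 ≤ min (‖x‖ ^ 2 / 1024) (κ * (n : ℝ) ^ τ) := by positivity
      gcongr
    refine h1.trans ?_
    rcases min_choice (‖x‖ ^ 2 / 1024) (κ * (n : ℝ) ^ τ) with h | h <;> rw [h]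
    · have e : c₀ * (‖x‖ ^ 2 / 1024) / 2 = c₀ / 2048 * ‖x‖ ^ 2 := by ring
      rw [e]
      exact le_add_of_nonneg_right (by positivity)
    · have e : c₀ * (κ * (n : ℝ) ^ τ) / 2 = c₀ * κ / 2 * (n : ℝ) ^ τ := by ring
      rw [e]
      exact hexpn.trans (le_add_of_nonneg_left (Real.exp_pos _).le)
  have hvol : ∀ r : ℝ, 0 ≤ r →
      volume.real (Metric.ball (0 : EuclideanSpace ℝ (Fin 4)) r) = r ^ 4 * V := by
    intro r hr
    rw [measureReal_def, Measure.addHaar_ball _ _ hr, ENNReal.toReal_mul,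
      ENNReal.toReal_ofReal (by positivity), finrank_euclideanSpace_fin, hV, measureReal_def]
  have hGi := integrable_exp_neg_mul_norm_sq (show 0 < c₀ / 2048 by positivity)
  have hfin : volume (Metric.ball (0 : EuclideanSpace ℝ (Fin 4)) (2 * (n : ℝ) ^ C)) < ⊤ :=
    measure_ball_lt_top
  have hci : IntegrableOn (fun _ => (n : ℝ) ^ (-(4 * C)))
      (Metric.ball (0 : EuclideanSpace ℝ (Fin 4)) (2 * (n : ℝ) ^ C)) :=
    integrableOn_const hfin.ne
  have hI : ∫ x in Metric.ball (0 : EuclideanSpace ℝ (Fin 4)) (2 * (n : ℝ) ^ C),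
      ‖charFun (P.map X) x‖ ≤ G + 16 * V := by
    calc _ ≤ ∫ x in Metric.ball (0 : EuclideanSpace ℝ (Fin 4)) (2 * (n : ℝ) ^ C),
          (Real.exp (-(c₀ / 2048 * ‖x‖ ^ 2)) + (n : ℝ) ^ (-(4 * C))) := by
          refine integral_mono_of_nonneg (Filter.Eventually.of_forall fun _ => norm_nonneg _)
            (hGi.integrableOn.add hci) ?_
          filter_upwards [ae_restrict_mem Metric.isOpen_ball.measurableSet] with x hx
          exact hchar x hx
      _ ≤ G + 16 * V := by
          rw [integral_add hGi.integrableOn hci]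
          refine add_le_add (setIntegral_le_integral hGi
            (Filter.Eventually.of_forall fun _ => (Real.exp_pos _).le)) (le_of_eq ?_)
          rw [setIntegral_const, hvol _ (by positivity), smul_eq_mul]
          have e : (n : ℝ) ^ (-(4 * C)) = δ ^ 4 := by
            rw [hδ, ← Real.rpow_natCast, ← Real.rpow_mul hn0.le]
            congr 1; push_cast; ring
          rw [e]
          calc _ = 16 * V * (δ * (n : ℝ) ^ C) ^ 4 := by ring
            _ = _ := by rw [hδn]; ring
  have hess := measureReal_ball_mul_volume_le (P.map X) a (show 0 < (n : ℝ) ^ C by positivity)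
  have hball : 1 / (n : ℝ) ^ C = δ := by rw [← hδn]; field_simp
  rw [hball, hvol _ (by positivity), map_measureReal_apply_of_aemeasurable hXm
    Metric.isOpen_ball.measurableSet] at hess
  have hmain : P.real (X ⁻¹' Metric.ball a δ) ≤ 4 * (G + 16 * V) / V * δ ^ 4 := by
    have h1 : P.real (X ⁻¹' Metric.ball a δ) * V ≤ 4 * (G + 16 * V) * δ ^ 4 := by
      calc P.real (X ⁻¹' Metric.ball a δ) * V
          = P.real (X ⁻¹' Metric.ball a δ) * (((n : ℝ) ^ C) ^ 4 * V) * δ ^ 4 := by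
            calc _ = P.real (X ⁻¹' Metric.ball a δ) * V * (δ * (n : ℝ) ^ C) ^ 4 := by
                  rw [hδn]; ring
              _ = _ := by ring
        _ ≤ 4 * (G + 16 * V) * δ ^ 4 := by
            refine mul_le_mul_of_nonneg_right ?_ (by positivity)
            linarith
    rw [div_mul_eq_mul_div, le_div_iff₀ hV0]
    exact h1
  rw [add_mul]
  exact hmain.trans (le_add_of_nonneg_right (by positivity))
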